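/- **Setting.** Let $d\ge 2$ and let $\mathcal A\subset\mathbb R^d$ be a finite nonempty set of $K$ actions with $\|a\|_2\le 1$. Let $\theta_*,\phi_*\in\mathbb R^d$ and $\omega\in\mathbb R$ satisfy $\|\theta_*\|_2\le 1$, $\|\phi_*\|_2\le\omega$. Put $f(x)=x+\omega$ and let $\sigma_{\max}>0$ satisfy $f(\langle\phi_*,a\rangle)\le\sigma_{\max}^2$ for all $a\in\mathcal A$. Selecting $A_t\in\mathcal A$ at time $t$ yields the reward $X_t=\langle A_t,\theta_*\rangle+\eta_t(A_t)$, where $\eta_t(a)\sim\mathcal N(0,f(\langle\phi_*,a\rangle))$ and the noise vectors $(\eta_t(a))_{a\in\mathcal A}$ of different times $t$ are independent. **Algorithm RISE++.** Its inputs are $\mathcal A$, $\omega$, a risk tolerance $\rho\ge 0$, a horizon $T\ge 2$, a number $\delta>0$ and a constant $\hat C$. Put $\varepsilon_\ell=2^{-\ell}$ and $\mathcal A_1=\mathcal A$. In phase $\ell=1,2,\dots$ the algorithm takes a minimizer $Q_\ell^*$ of $$g_\ell(Q)=\max_{a\in\mathcal A_\ell}a^\top\Big(\sum_{b\in\mathcal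 A_\ell}Q(b)\,bb^\top\Big)^{-1}a$$ over the probability distributions $Q$ on $\mathcal A_\ell$, and plays each $a\in\mathcal A_\ell$, in an order fixed in advance as a function of $\ell$ and $\mathcal A_\ell$, exactly $$n_{\ell,a}=\Big\lceil \hat C^2\,\frac{d^2 g_\ell(Q_\ell^*)\log(d)\,Q_\ell^*(a)}{\varepsilon_\ell^2}\,\log^2\!\Big(\frac{KT}{\delta}\Big)\Big\rceil$$ times. With $V_{(\ell)}=\sum_{a\in\mathcal A_\ell}n_{\ell,a}aa^\top$ and with sums over the rounds $t$ of phase $\ell$ it computes $$\hat\theta_{(\ell)}=V_{(\ell)}^{-1}\sum_t X_tA_t,\qquad \hat\phi_{(\ell)}=V_{(\ell)}^{-1}\sum_t f^{-1}\big((X_t-\langle\hat\theta_{(\ell)},A_t\rangle)^2\big)A_t,$$ and sets $$\mathcal A_{\ell+1}=\{a\in\mathcal A_\ell:\max_{b\in\mathcal A_\ell}\langle\rho\hat\theta_{(\ell)}-\hat\phi_{(\ell)},b-a\rangle\le 2\varepsilon_\ell\}.$$ If a matrix $V$ here is singular, $V^{-1}$ denotes its Moore–Penrose inverse, and $a^\top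 V^{-1}a=\infty$ in $g_\ell$ if $a\notin\operatorname{range}V$. The phase $\ell$ is completed if all its rounds are among the first $T$. **Claim.** There is an absolute constant $C_4>0$ such that, for all data as above for which $\hat C$ satisfies $$8\rho\,\sigma_{\max}\sqrt{d+\log(2T^2\delta^{-1})}+C_4\,\sigma_{\max}^2\,d\sqrt{\log d}\,\log(T\delta^{-1})\le\hat C\,d\sqrt{\log d}\,\log(T\delta^{-1}),$$ one has $$\mathbb P\Big(\big|\langle\rho\theta_*-\phi_*-(\rho\hat\theta_{(\ell)}-\hat\phi_{(\ell)}),a\rangle\big|\le\varepsilon_\ell\ \text{ for all completed phases }\ell\ge1\text{ and all }a\in\mathcal A_\ell\Big)\ge 1-\delta .$$ -/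

import Mathlib

open MeasureTheory ProbabilityTheory
open scoped ENNReal

noncomputable section

namespace RiskBandit

/-- `ℝ^d` with the Euclidean norm. -/
abbrev Vec (d : ℕ) := EuclideanSpace ℝ (Fin d)

/-- A linear bandit instance: a finite nonempty set `𝒜 ⊂ ℝ^d` of actions in the unit ball, the mean
parameter `θ`, the variance parameter `φ`, and the offset `ω` of the link `f(x) = x + ω`. -/
structure Bandit (d : ℕ) where
  actions : Finset (Vec d)
  θ : Vec d
  φ : Vec d
  ω : ℝ
  actions_nonempty : actions.Nonempty
  norm_action_le : ∀ a ∈ actions, ‖a‖ ≤ 1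
  norm_θ_le : ‖θ‖ ≤ 1
  norm_φ_le : ‖φ‖ ≤ ω

/-- The link function `f(x) = x + ω`. -/
def link (ω x : ℝ) : ℝ := x + ω

/-- The inverse link `f⁻¹(y) = y - ω`. -/
def linkInv (ω y : ℝ) : ℝ := y - ω

theorem linkInv_link (ω x : ℝ) : linkInv ω (link ω x) = x := by simp [link, linkInv]

theorem link_linkInv (ω y : ℝ) : link ω (linkInv ω y) = y := by simp [link, linkInv]

/-- The reward variance `f(⟨φ, a⟩)` of action `a`. -/
def Bandit.variance {d : ℕ} (B : Bandit d) (a : Vec d) : ℝ := link B.ω (inner ℝ B.φ a)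

/-- The noise variables `η_t(a)` (time `t = 0, 1, …`, action `a`): each is `N(0, f(⟨φ, a⟩))`, and the
noise vectors `(η_t(a))_{a ∈ 𝒜}` of different times are independent. Nothing is assumed on the
dependence between the noises of different actions at one time. -/
structure IsNoise {d : ℕ} (B : Bandit d) {Ω : Type*} [MeasurableSpace Ω] (μ : Measure Ω)
    (η : ℕ → Vec d → Ω → ℝ) : Prop where
  measurable : ∀ t, ∀ a ∈ B.actions, Measurable (η t a)
  law : ∀ t, ∀ a ∈ B.actions, μ.map (η t a) = gaussianReal 0 (B.variance a).toNNReal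
  indep : iIndepFun (fun (t : ℕ) (w : Ω) (a : B.actions) => η t a w) μ

/-- The reward `⟨a, θ⟩ + η_t(a)` that is observed if action `a` is selected at time `t`. -/
def Bandit.reward {d : ℕ} (B : Bandit d) {Ω : Type*} (η : ℕ → Vec d → Ω → ℝ) (w : Ω)
    (t : ℕ) (a : Vec d) : ℝ :=
  inner ℝ a B.θ + η t a w

/-! ### G-optimal designs -/

/-- The matrix `∑_{a ∈ S} c(a) a aᵀ`. -/
def designMatrix {d : ℕ} (S : Finset (Vec d)) (c : Vec d → ℝ) : Matrix (Fin d) (Fin d) ℝ :=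
  ∑ a ∈ S, c a • Matrix.vecMulVec a.ofLp a.ofLp

/-- The (Moore–Penrose) inverse of a symmetric matrix: nonzero eigenvalues are inverted and the
kernel is kept. It is `V⁻¹` when `V` is invertible, see `pinv_eq_inv`. -/
def pinv {d : ℕ} (V : Matrix (Fin d) (Fin d) ℝ) : Matrix (Fin d) (Fin d) ℝ :=
  cfc (fun x : ℝ => x⁻¹) V

theorem mul_pinv_mul {d : ℕ} {V : Matrix (Fin d) (Fin d) ℝ} (hV : V.IsHermitian) :
    V * pinv V * V = V := by
  have hs : IsSelfAdjoint V := hV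
  have hf : ∀ f : ℝ → ℝ, ContinuousOn f (spectrum ℝ V) := fun f =>
    (Matrix.finite_real_spectrum (A := V)).continuousOn f
  calc V * pinv V * V
      = cfc (fun x : ℝ => x) V * cfc (fun x : ℝ => x⁻¹) V * cfc (fun x : ℝ => x) V := by
        rw [cfc_id' ℝ V, pinv]
    _ = cfc (fun x : ℝ => x * x⁻¹ * x) V := by
        rw [← cfc_mul _ _ V (hf _) (hf _), ← cfc_mul _ _ V (hf _) (hf _)]
    _ = V := by
        simp only [mul_inv_mul_cancel]
        exact cfc_id' ℝ V

theorem pinv_eq_inv {d : ℕ} {V : Matrix (Fin d) (Fin d) ℝ} (hV : V.IsHermitian)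
    (hdet : IsUnit V.det) : pinv V = V⁻¹ := by
  have h := mul_pinv_mul hV
  have h1 : V * pinv V = 1 := by
    calc V * pinv V = V * pinv V * V * V⁻¹ := by
          rw [Matrix.mul_assoc _ V, Matrix.mul_nonsing_inv V hdet, Matrix.mul_one]
      _ = 1 := by rw [h, Matrix.mul_nonsing_inv V hdet]
  exact (Matrix.inv_eq_right_inv h1).symm

open Classical in
/-- `aᵀ V⁻¹ a` for a positive semidefinite `V`, with the value `∞` when `a` is not in the range
of `V`. -/
def invQuad {d : ℕ} (V : Matrix (Fin d) (Fin d) ℝ) (a : Vec d) : ℝ≥0∞ :=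
  if a ∈ LinearMap.range (Matrix.toEuclideanLin V) then
    ENNReal.ofReal (inner ℝ a (Matrix.toEuclideanLin (pinv V) a))
  else ∞

/-- The G-criterion `g(Q) = max_{a ∈ S} aᵀ (∑_{b ∈ S} Q(b) b bᵀ)⁻¹ a`. -/
def gValue {d : ℕ} (S : Finset (Vec d)) (Q : Vec d → ℝ) : ℝ≥0∞ :=
  ⨆ a ∈ S, invQuad (designMatrix S Q) a

/-- `Q` restricts to a probability distribution on `S`. -/
def IsDesign {d : ℕ} (S : Finset (Vec d)) (Q : Vec d → ℝ) : Prop :=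
  (∀ a ∈ S, 0 ≤ Q a) ∧ ∑ a ∈ S, Q a = 1

/-- `Q` minimizes the G-criterion among all probability distributions on `S`. -/
def IsGOptimal {d : ℕ} (S : Finset (Vec d)) (Q : Vec d → ℝ) : Prop :=
  IsDesign S Q ∧ ∀ Q' : Vec d → ℝ, IsDesign S Q' → gValue S Q ≤ gValue S Q'

/-! ### The successive elimination algorithm -/

/-- The tolerance `ε_ℓ = 2^{-ℓ}`. -/
def tol (ℓ : ℕ) : ℝ := (1 / 2 : ℝ) ^ ℓ

/-- What the algorithm is given: the action set, the offset `ω`, the risk tolerance `ρ`, the horizon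
`T`, the confidence `δ`, the constant `Ĉ`, a rule `design` that picks a design for each phase and
active set, and a rule `schedule` that lists the actions of a phase in the order in which they are
played. -/
structure Input (d : ℕ) where
  actions : Finset (Vec d)
  ω : ℝ
  ρ : ℝ
  T : ℕ
  δ : ℝ
  Chat : ℝ
  design : ℕ → Finset (Vec d) → Vec d → ℝ
  schedule : ℕ → Finset (Vec d) → List (Vec d)

namespace Input

variable {d : ℕ} (I : Input d)

/-- The number `n_{ℓ,a}` of plays of `a` in phase `ℓ` when the active set is `S`:
`⌈Ĉ² d² g(Q) log(d) Q(a) / ε_ℓ² · log²(K T / δ)⌉` with `Q` the design of the phase. -/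
def plays (ℓ : ℕ) (S : Finset (Vec d)) (a : Vec d) : ℕ :=
  ⌈I.Chat ^ 2 * ((d : ℝ) ^ 2 * (gValue S (I.design ℓ S)).toReal * Real.log d * I.design ℓ S a
      / tol ℓ ^ 2) * Real.log ((I.actions.card : ℝ) * I.T / I.δ) ^ 2⌉₊

open Classical in
/-- The selection rules do what the algorithm prescribes: every design is G-optimal, and every
schedule contains each active action `a` exactly `n_{ℓ,a}` times, and no other action. -/
def Valid : Prop :=
  ∀ ℓ : ℕ, 1 ≤ ℓ → ∀ S ⊆ I.actions, S.Nonempty →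
    IsGOptimal S (I.design ℓ S) ∧
      ∀ a : Vec d, (I.schedule ℓ S).count a = if a ∈ S then I.plays ℓ S a else 0

/-- The design matrix `V_(ℓ) = ∑_{a ∈ S} n_{ℓ,a} a aᵀ` of a phase with active set `S`. -/
def phaseMatrix (ℓ : ℕ) (S : Finset (Vec d)) : Matrix (Fin d) (Fin d) ℝ :=
  designMatrix S (fun a => (I.plays ℓ S a : ℝ))

/-- The estimate of `θ` in phase `ℓ`, when the phase starts at time `s` with active set `S`. The
`i`-th action of the phase is `A = L[i]` with `L` the schedule; it is played at time `s + i`, and its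
reward is `X = r (s + i) A`. The estimate is `V⁻¹ ∑ X A`. -/
def thetaHat (r : ℕ → Vec d → ℝ) (ℓ s : ℕ) (S : Finset (Vec d)) : Vec d :=
  Matrix.toEuclideanLin (pinv (I.phaseMatrix ℓ S))
    (∑ i : Fin (I.schedule ℓ S).length,
      r (s + i) ((I.schedule ℓ S).get i) • (I.schedule ℓ S).get i)

/-- The estimate `V⁻¹ ∑ f⁻¹((X - ⟨θ̂, A⟩)²) A` of `φ` in phase `ℓ`, in the notation of
`thetaHat`. -/
def phiHat (r : ℕ → Vec d → ℝ) (ℓ s : ℕ) (S : Finset (Vec d)) : Vec d :=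
  Matrix.toEuclideanLin (pinv (I.phaseMatrix ℓ S))
    (∑ i : Fin (I.schedule ℓ S).length,
      linkInv I.ω ((r (s + i) ((I.schedule ℓ S).get i)
          - inner ℝ (I.thetaHat r ℓ s S) ((I.schedule ℓ S).get i)) ^ 2)
        • (I.schedule ℓ S).get i)

open Classical in
/-- The actions of `S` that survive phase `ℓ`: those `a` with
`⟨ρ θ̂ - φ̂, b - a⟩ ≤ 2 ε_ℓ` for every `b ∈ S`. -/
def survivors (r : ℕ → Vec d → ℝ) (ℓ s : ℕ) (S : Finset (Vec d)) : Finset (Vec d) :=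
  S.filter fun a => ∀ b ∈ S,
    inner ℝ (I.ρ • I.thetaHat r ℓ s S - I.phiHat r ℓ s S) (b - a) ≤ 2 * tol ℓ

/-- The start time and the active set of phase `ℓ = 1, 2, …` on the reward table `r`. Times are
counted from `0`. The value at `0` is a dummy. -/
def phase (r : ℕ → Vec d → ℝ) : ℕ → ℕ × Finset (Vec d)
  | 0 => (0, I.actions)
  | 1 => (0, I.actions)
  | ℓ + 2 =>
    let p := phase r (ℓ + 1)
    (p.1 + (I.schedule (ℓ + 1) p.2).length, I.survivors r (ℓ + 1) p.1 p.2)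

/-- The time at which phase `ℓ` starts. -/
def startTime (r : ℕ → Vec d → ℝ) (ℓ : ℕ) : ℕ := (I.phase r ℓ).1

/-- The active set `𝒜_ℓ` of phase `ℓ`. -/
def active (r : ℕ → Vec d → ℝ) (ℓ : ℕ) : Finset (Vec d) := (I.phase r ℓ).2

/-- Phase `ℓ` is completed within the horizon, that is, its rounds are among the first `T`. -/
def Completed (r : ℕ → Vec d → ℝ) (ℓ : ℕ) : Prop :=
  I.startTime r ℓ + (I.schedule ℓ (I.active r ℓ)).length ≤ I.T

/-- The estimate `θ̂_(ℓ)` that the algorithm computes at the end of phase `ℓ`. -/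
def thetaEst (r : ℕ → Vec d → ℝ) (ℓ : ℕ) : Vec d :=
  I.thetaHat r ℓ (I.startTime r ℓ) (I.active r ℓ)

/-- The estimate `φ̂_(ℓ)` that the algorithm computes at the end of phase `ℓ`. -/
def phiEst (r : ℕ → Vec d → ℝ) (ℓ : ℕ) : Vec d :=
  I.phiHat r ℓ (I.startTime r ℓ) (I.active r ℓ)

end Input

end RiskBandit

end

namespace RiskBandit

variable {d : ℕ}

/-! ### Quadratic forms and the pseudo-inverse -/

/-! Fix a phase with start time `s` and active set `S`. Let V be its design matrix, V⁺ = `pinv V`,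
and N² = aᵀV⁺a. Both estimates are linear in their responses, with weights w_i = ⟨A_i, V⁺a⟩
satisfying ∑ w_i² = N². Their errors in direction a are ∑ w_i e_i for θ and ∑ w_i((e_i + Δ_i)² -
v_i) for φ, where e_i is the noise, v_i its variance and Δ_i = ⟨θ - θ̂, A_i⟩. AM-GM splits the cross
term into N⁻¹ ∑ w_i² e_i² and N ∑ Δ_i²; the trace bound ∑ A_iᵀV⁺A_i ≤ d controls the latter. So
three tail bounds per nonzero action (`NoiseControlled`) give an error of at most N(ρσ√(2l) + σ²d(8l
+ 5)), which is `abs_inner_error_le`.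

The factor g(Q) in the number of plays cancels against aᵀM(Q)⁺a ≤ g(Q), where M(Q) is the normalized
design matrix, so N² ≤ 1/`scale`. The Kiefer–Wolfowitz value of g is never needed: optimality serves
only to make g finite. For l = log(5KT/δ), `width_mul_le` bounds the resulting width by ε_ℓ.

The state (s, S) of a phase is random, but the event of being in it depends on the noise before s
only, and the bad event of that state on the noise from s on. By independence and disjointness of
the states, a phase fails with probability at most δ/T, with no union bound over active sets
(`measureReal_biUnion_inter_le`). A phase with a nonzero active action lasts at least one round, so
only T phases matter. -/

theorem inner_designMatrix (S : Finset (Vec d)) (c : Vec d → ℝ) (x y : Vec d) :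
    inner ℝ x (Matrix.toEuclideanLin (designMatrix S c) y)
      = ∑ a ∈ S, c a * (inner ℝ a x * inner ℝ a y) := by
  rw [designMatrix, map_sum, LinearMap.sum_apply, inner_sum]
  refine Finset.sum_congr rfl fun a _ => ?_
  rw [map_smul, LinearMap.smul_apply, inner_smul_right, Matrix.toLpLin_apply,
    Matrix.vecMulVec_mulVec]
  congr 1
  simp [PiLp.inner_apply, dotProduct, Finset.mul_sum, Finset.sum_mul]
  rw [Finset.sum_comm]
  exact Finset.sum_congr rfl fun i _ => Finset.sum_congr rfl fun j _ => by ring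

theorem isHermitian_designMatrix (S : Finset (Vec d)) (c : Vec d → ℝ) :
    (designMatrix S c).IsHermitian := by
  unfold designMatrix Matrix.IsHermitian
  rw [Matrix.conjTranspose_sum]
  refine Finset.sum_congr rfl fun a _ => ?_
  rw [Matrix.conjTranspose_smul, Matrix.conjTranspose_vecMulVec]
  simp

theorem isHermitian_pinv (V : Matrix (Fin d) (Fin d) ℝ) : (pinv V).IsHermitian :=
  cfc_predicate (R := ℝ) (p := IsSelfAdjoint) (fun x : ℝ => x⁻¹) V

theorem inner_toEuclideanLin_comm {M : Matrix (Fin d) (Fin d) ℝ} (hM : M.IsHermitian)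
    (x y : Vec d) :
    inner ℝ (Matrix.toEuclideanLin M x) y = inner ℝ x (Matrix.toEuclideanLin M y) :=
  Matrix.isSymmetric_toEuclideanLin_iff.2 hM x y

theorem apply_pinv_apply {V : Matrix (Fin d) (Fin d) ℝ} (hV : V.IsHermitian) {a : Vec d}
    (ha : a ∈ LinearMap.range (Matrix.toEuclideanLin V)) :
    Matrix.toEuclideanLin V (Matrix.toEuclideanLin (pinv V) a) = a := by
  obtain ⟨y, rfl⟩ := ha
  have h := congrArg (fun M => Matrix.toEuclideanLin M y) (mul_pinv_mul hV)
  simpa [Matrix.toLpLin_mul_same, Matrix.mul_assoc] using h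

theorem inner_pinv_apply_left {V : Matrix (Fin d) (Fin d) ℝ} (y a : Vec d) :
    inner ℝ (Matrix.toEuclideanLin (pinv V) y) a
      = inner ℝ y (Matrix.toEuclideanLin (pinv V) a) :=
  inner_toEuclideanLin_comm (isHermitian_pinv V) y a

/-- The hypothesis says aaᵀ ≤ mV as forms. It makes a orthogonal to ker V, and the range of a
symmetric V is (ker V)ᗮ. -/
theorem mem_range_of_sq_inner_le {V : Matrix (Fin d) (Fin d) ℝ} (hV : V.IsHermitian) {a : Vec d}
    {m : ℝ} (h : ∀ x, inner ℝ a x ^ 2 ≤ m * inner ℝ x (Matrix.toEuclideanLin V x)) :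
    a ∈ LinearMap.range (Matrix.toEuclideanLin V) := by
  have hs := Matrix.isSymmetric_toEuclideanLin_iff.2 hV
  rw [← Submodule.orthogonal_orthogonal (LinearMap.range (Matrix.toEuclideanLin V)),
    hs.orthogonal_range, Submodule.mem_orthogonal]
  intro x hx
  have h1 := h x
  rw [LinearMap.mem_ker.1 hx, inner_zero_right, mul_zero] at h1
  rw [real_inner_comm]
  exact pow_eq_zero_iff two_ne_zero |>.1 (le_antisymm h1 (sq_nonneg _))

/-- Testing the form inequality at x = V⁺a gives q² ≤ mq for q = aᵀV⁺a. This replaces any appeal to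
antitonicity of the inverse. -/
theorem inner_pinv_le_of_sq_inner_le {V : Matrix (Fin d) (Fin d) ℝ} (hV : V.IsHermitian)
    {a : Vec d} {m : ℝ} (hm : 0 ≤ m)
    (h : ∀ x, inner ℝ a x ^ 2 ≤ m * inner ℝ x (Matrix.toEuclideanLin V x)) :
    inner ℝ a (Matrix.toEuclideanLin (pinv V) a) ≤ m := by
  have ha := mem_range_of_sq_inner_le hV h
  have h1 := h (Matrix.toEuclideanLin (pinv V) a)
  rw [apply_pinv_apply hV ha, real_inner_comm a] at h1
  by_contra! hc
  nlinarith

/-- Cauchy–Schwarz for the form of V, applied to x and u = V⁺a, since a = Vu. -/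
theorem sq_inner_le_designMatrix {S : Finset (Vec d)} {c : Vec d → ℝ} (hc : ∀ b ∈ S, 0 ≤ c b)
    {a : Vec d} (ha : a ∈ LinearMap.range (Matrix.toEuclideanLin (designMatrix S c)))
    (x : Vec d) :
    inner ℝ a x ^ 2 ≤ inner ℝ a (Matrix.toEuclideanLin (pinv (designMatrix S c)) a)
      * inner ℝ x (Matrix.toEuclideanLin (designMatrix S c) x) := by
  have hV := isHermitian_designMatrix S c
  set u := Matrix.toEuclideanLin (pinv (designMatrix S c)) a with hu
  have hua : Matrix.toEuclideanLin (designMatrix S c) u = a := apply_pinv_apply hV ha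
  have h1 : inner ℝ a x = ∑ b ∈ S, (√(c b) * inner ℝ b u) * (√(c b) * inner ℝ b x) := by
    rw [← hua, inner_toEuclideanLin_comm hV, inner_designMatrix]
    refine Finset.sum_congr rfl fun b hb => ?_
    linear_combination (inner ℝ b u * inner ℝ b x) * -(Real.mul_self_sqrt (hc b hb))
  have h2 : inner ℝ a u = ∑ b ∈ S, (√(c b) * inner ℝ b u) ^ 2 := by
    conv_lhs => rw [← hua]
    rw [inner_toEuclideanLin_comm hV, inner_designMatrix]
    refine Finset.sum_congr rfl fun b hb => ?_
    linear_combination (inner ℝ b u * inner ℝ b u) * -(Real.mul_self_sqrt (hc b hb))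
  have h3 : inner ℝ x (Matrix.toEuclideanLin (designMatrix S c) x)
      = ∑ b ∈ S, (√(c b) * inner ℝ b x) ^ 2 := by
    rw [inner_designMatrix]
    refine Finset.sum_congr rfl fun b hb => ?_
    linear_combination (inner ℝ b x * inner ℝ b x) * -(Real.mul_self_sqrt (hc b hb))
  rw [h1, h2, h3]
  exact Finset.sum_mul_sq_le_sq_mul_sq _ _ _

/-- V⁺V is an orthogonal projection P, and P_ii = ∑_j P_ij² ≥ P_ii² forces every diagonal entry to
be at most 1. -/
theorem trace_pinv_mul_le {V : Matrix (Fin d) (Fin d) ℝ} (hV : V.IsHermitian) :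
    (pinv V * V).trace ≤ d := by
  have hs : IsSelfAdjoint V := hV
  have hcomm : Commute V (pinv V) := by
    have := cfc_commute_cfc (fun x : ℝ => x) (fun x : ℝ => x⁻¹) V
    rwa [cfc_id' ℝ V] at this
  set P := pinv V * V with hP
  have hidem : P * P = P := by
    rw [hP, Matrix.mul_assoc, ← Matrix.mul_assoc V, mul_pinv_mul hV]
  have hsymm : P.IsHermitian := by
    rw [Matrix.IsHermitian, hP, Matrix.conjTranspose_mul, isHermitian_pinv V, hV]
    exact hcomm
  have hdiag : ∀ i, P i i ≤ 1 := by
    intro i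
    have h1 : P i i = ∑ j, P i j ^ 2 := by
      conv_lhs => rw [← hidem, Matrix.mul_apply]
      refine Finset.sum_congr rfl fun j _ => ?_
      have := hsymm.apply i j
      simp only [star_trivial] at this
      rw [this, sq]
    have h2 : P i i ^ 2 ≤ P i i := by
      conv_rhs => rw [h1]
      exact Finset.single_le_sum (f := fun j => P i j ^ 2) (fun j _ => sq_nonneg _)
        (Finset.mem_univ i)
    by_contra! hc
    nlinarith
  calc P.trace = ∑ i, P i i := rfl
    _ ≤ ∑ _i : Fin d, (1 : ℝ) := Finset.sum_le_sum fun i _ => hdiag i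
    _ = d := by simp

theorem sum_inner_pinv_le (S : Finset (Vec d)) (c : Vec d → ℝ) :
    ∑ a ∈ S, c a * inner ℝ a (Matrix.toEuclideanLin (pinv (designMatrix S c)) a) ≤ d := by
  refine le_trans (le_of_eq ?_) (trace_pinv_mul_le (isHermitian_designMatrix S c))
  generalize pinv (designMatrix S c) = W
  rw [designMatrix, Matrix.mul_sum, Matrix.trace_sum]
  refine Finset.sum_congr rfl fun a _ => ?_
  rw [Matrix.mul_smul, Matrix.trace_smul, Matrix.mul_vecMulVec, Matrix.trace_vecMulVec,
    smul_eq_mul]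
  simp [PiLp.inner_apply, dotProduct, Matrix.toLpLin_apply]

/-! ### Finiteness of the optimal G-value -/

theorem invQuad_le_of_sq_inner_le {V : Matrix (Fin d) (Fin d) ℝ} (hV : V.IsHermitian)
    {a : Vec d} {m : ℝ} (hm : 0 ≤ m)
    (h : ∀ x, inner ℝ a x ^ 2 ≤ m * inner ℝ x (Matrix.toEuclideanLin V x)) :
    invQuad V a ≤ ENNReal.ofReal m := by
  rw [invQuad, if_pos (mem_range_of_sq_inner_le hV h)]
  exact ENNReal.ofReal_le_ofReal (inner_pinv_le_of_sq_inner_le hV hm h)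

/-- The uniform design has G-value at most |S|. This is the only use of optimality. -/
theorem IsGOptimal.gValue_ne_top {S : Finset (Vec d)} (hS : S.Nonempty) {Q : Vec d → ℝ}
    (hQ : IsGOptimal S Q) : gValue S Q ≠ ∞ := by
  have hcard : (0 : ℝ) < S.card := by exact_mod_cast hS.card_pos
  have hunif : IsDesign S (fun _ => (S.card : ℝ)⁻¹) := by
    refine ⟨fun a _ => by positivity, ?_⟩
    rw [Finset.sum_const, nsmul_eq_mul, mul_inv_cancel₀ hcard.ne']
  refine ne_top_of_le_ne_top (ENNReal.ofReal_ne_top (r := S.card))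
    ((hQ.2 _ hunif).trans (iSup₂_le fun a ha => ?_))
  refine invQuad_le_of_sq_inner_le (isHermitian_designMatrix _ _) hcard.le fun x => ?_
  rw [inner_designMatrix, ← Finset.mul_sum, ← mul_assoc, mul_inv_cancel₀ hcard.ne', one_mul, sq]
  exact Finset.single_le_sum (f := fun b => inner ℝ b x * inner ℝ b x)
    (fun b _ => mul_self_nonneg _) ha

theorem sq_inner_le_gValue {S : Finset (Vec d)} {Q : Vec d → ℝ} (hQ : IsDesign S Q)
    (hg : gValue S Q ≠ ∞) {a : Vec d} (ha : a ∈ S) (x : Vec d) :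
    inner ℝ a x ^ 2 ≤ (gValue S Q).toReal * ∑ b ∈ S, Q b * inner ℝ b x ^ 2 := by
  have hle : invQuad (designMatrix S Q) a ≤ gValue S Q :=
    le_iSup₂ (f := fun a (_ : a ∈ S) => invQuad (designMatrix S Q) a) a ha
  have hr : a ∈ LinearMap.range (Matrix.toEuclideanLin (designMatrix S Q)) := by
    by_contra hr
    rw [invQuad, if_neg hr] at hle
    exact hg (top_le_iff.1 hle)
  rw [invQuad, if_pos hr, ENNReal.ofReal_le_iff_le_toReal hg] at hle
  have h1 := sq_inner_le_designMatrix hQ.1 hr x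
  rw [inner_designMatrix] at h1
  simp only [← sq] at h1
  exact h1.trans (mul_le_mul_of_nonneg_right hle
    (Finset.sum_nonneg fun b hb => mul_nonneg (hQ.1 b hb) (sq_nonneg _)))

/-! ### The estimation error of one phase, for fixed noise -/

/-- Error of the variance estimate caused by squaring residuals e + Δ in place of the true noise e.
-/
theorem abs_sum_mul_sq_add_sub_le {ι : Type*} [Fintype ι] {w e v Δ : ι → ℝ} {N σ l m : ℝ}
    (hN : 0 < N) (hw : ∑ i, w i ^ 2 = N ^ 2) (hv : ∀ i, v i ≤ σ ^ 2)
    (h1 : |∑ i, w i * (e i ^ 2 - v i)| ≤ 4 * σ ^ 2 * N * (l + 1))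
    (h2 : ∑ i, w i ^ 2 * (e i ^ 2 - v i) ≤ 4 * σ ^ 2 * N ^ 2 * (l + 1))
    (h3 : ∑ i, Δ i ^ 2 ≤ m) :
    |∑ i, w i * ((e i + Δ i) ^ 2 - v i)| ≤ σ ^ 2 * N * (8 * l + 9) + 2 * N * m := by
  have hwN : ∀ i, |w i| ≤ N := fun i => by
    rw [← abs_of_pos hN]
    exact sq_le_sq.1 ((Finset.single_le_sum (f := fun i => w i ^ 2) (fun j _ => sq_nonneg _)
      (Finset.mem_univ i)).trans hw.le)
  have hsplit : ∑ i, w i * ((e i + Δ i) ^ 2 - v i)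
      = ∑ i, w i * (e i ^ 2 - v i) + ∑ i, (2 * (w i * e i) * Δ i + w i * Δ i ^ 2) := by
    rw [← Finset.sum_add_distrib]
    exact Finset.sum_congr rfl fun i _ => by ring
  have hterm : ∀ i, |2 * (w i * e i) * Δ i + w i * Δ i ^ 2|
      ≤ w i ^ 2 * e i ^ 2 / N + 2 * N * Δ i ^ 2 := by
    intro i
    -- AM-GM with weight N: the factor w_i² e_i² / N can be summed with `h2`, while Δ_i² keeps no
    -- dependence on w_i.
    have hcross : |2 * (w i * e i) * Δ i| ≤ w i ^ 2 * e i ^ 2 / N + N * Δ i ^ 2 := by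
      have key : 0 ≤ (|w i * e i| - N * |Δ i|) ^ 2 / N := by positivity
      have hexp : (|w i * e i| - N * |Δ i|) ^ 2 / N
          = w i ^ 2 * e i ^ 2 / N + N * Δ i ^ 2 - 2 * |w i * e i| * |Δ i| := by
        rw [sub_sq, mul_pow, sq_abs, sq_abs, mul_pow]
        field_simp
        ring
      rw [abs_mul, abs_mul, abs_two]
      linarith
    have hsq : |w i * Δ i ^ 2| ≤ N * Δ i ^ 2 := by
      rw [abs_mul, abs_of_nonneg (sq_nonneg (Δ i))]
      exact mul_le_mul_of_nonneg_right (hwN i) (sq_nonneg _)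
    linarith [abs_add_le (2 * (w i * e i) * Δ i) (w i * Δ i ^ 2)]
  have hwe : ∑ i, w i ^ 2 * e i ^ 2 ≤ σ ^ 2 * N ^ 2 * (4 * l + 5) := by
    have hwv : ∑ i, w i ^ 2 * v i ≤ N ^ 2 * σ ^ 2 := by
      rw [← hw, Finset.sum_mul]
      exact Finset.sum_le_sum fun i _ => mul_le_mul_of_nonneg_left (hv i) (sq_nonneg _)
    simp only [mul_sub, Finset.sum_sub_distrib] at h2
    linarith
  calc _ ≤ |∑ i, w i * (e i ^ 2 - v i)| + ∑ i, (w i ^ 2 * e i ^ 2 / N + 2 * N * Δ i ^ 2) := by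
        rw [hsplit]
        refine (abs_add_le _ _).trans (add_le_add_right ?_ _)
        exact (Finset.abs_sum_le_sum_abs _ _).trans (Finset.sum_le_sum fun i _ => hterm i)
    _ ≤ 4 * σ ^ 2 * N * (l + 1) + (σ ^ 2 * N ^ 2 * (4 * l + 5) / N + 2 * N * m) := by
        rw [Finset.sum_add_distrib, ← Finset.sum_div, ← Finset.mul_sum]
        gcongr
    _ = σ ^ 2 * N * (8 * l + 9) + 2 * N * m := by field_simp; ring

section

variable {S : Finset (Vec d)} {c : Vec d → ℝ} {ι : Type*} [Fintype ι] {A : ι → Vec d}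

/-! ### Least squares along a fixed schedule -/

theorem sum_inner_mul_inner_pinv (hA : ∀ f : Vec d → ℝ, ∑ i, f (A i) = ∑ a ∈ S, c a * f a)
    {a : Vec d} (ha : a ∈ LinearMap.range (Matrix.toEuclideanLin (designMatrix S c)))
    (x : Vec d) :
    ∑ i, inner ℝ (A i) x * inner ℝ (A i) (Matrix.toEuclideanLin (pinv (designMatrix S c)) a)
      = inner ℝ x a := by
  have h := hA fun b =>
    inner ℝ b x * inner ℝ b (Matrix.toEuclideanLin (pinv (designMatrix S c)) a)
  rw [h, ← inner_designMatrix, apply_pinv_apply (isHermitian_designMatrix S c) ha]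

theorem inner_least_squares (hA : ∀ f : Vec d → ℝ, ∑ i, f (A i) = ∑ a ∈ S, c a * f a)
    {a : Vec d} (ha : a ∈ LinearMap.range (Matrix.toEuclideanLin (designMatrix S c)))
    (y : ι → ℝ) (x : Vec d) :
    inner ℝ (Matrix.toEuclideanLin (pinv (designMatrix S c)) (∑ i, y i • A i)) a
      = inner ℝ x a + ∑ i, inner ℝ (A i) (Matrix.toEuclideanLin (pinv (designMatrix S c)) a)
          * (y i - inner ℝ (A i) x) := by
  rw [inner_pinv_apply_left, sum_inner, ← sum_inner_mul_inner_pinv hA ha x,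
    ← Finset.sum_add_distrib]
  refine Finset.sum_congr rfl fun i _ => ?_
  rw [real_inner_smul_left]
  ring

/-- Deviation bounds for the linear and quadratic noise terms, in all directions of `S`. -/
def NoiseControlled (S : Finset (Vec d)) (c : Vec d → ℝ) (A : ι → Vec d) (v : ι → ℝ) (σ l : ℝ)
    (e : ι → ℝ) : Prop :=
  ∀ a ∈ S, a ≠ 0 → ∀ u, u = Matrix.toEuclideanLin (pinv (designMatrix S c)) a →
    |∑ i, inner ℝ (A i) u * e i| ≤ σ * √(inner ℝ u a) * √(2 * l) ∧
    |∑ i, inner ℝ (A i) u * (e i ^ 2 - v i)| ≤ 4 * σ ^ 2 * √(inner ℝ u a) * (l + 1) ∧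
    ∑ i, inner ℝ (A i) u ^ 2 * (e i ^ 2 - v i) ≤ 4 * σ ^ 2 * √(inner ℝ u a) ^ 2 * (l + 1)

theorem inner_pinv_nonneg (hc : ∀ b ∈ S, 0 ≤ c b)
    {a : Vec d} (ha : a ∈ LinearMap.range (Matrix.toEuclideanLin (designMatrix S c))) :
    0 ≤ inner ℝ (Matrix.toEuclideanLin (pinv (designMatrix S c)) a) a := by
  obtain ⟨u, hu⟩ : ∃ u, u = Matrix.toEuclideanLin (pinv (designMatrix S c)) a := ⟨_, rfl⟩
  have h := apply_pinv_apply (isHermitian_designMatrix S c) ha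
  rw [← hu] at h ⊢
  rw [← h, inner_designMatrix]
  exact Finset.sum_nonneg fun b hb => mul_nonneg (hc b hb) (mul_self_nonneg _)

/-- Strictness matters because the AM-GM step and the tail bounds divide by N. -/
theorem inner_pinv_pos (hc : ∀ b ∈ S, 0 ≤ c b)
    {a : Vec d} (ha : a ∈ LinearMap.range (Matrix.toEuclideanLin (designMatrix S c)))
    (h0 : a ≠ 0) :
    0 < inner ℝ (Matrix.toEuclideanLin (pinv (designMatrix S c)) a) a := by
  refine (inner_pinv_nonneg hc ha).lt_of_ne' fun h => h0 ?_
  have h1 := sq_inner_le_designMatrix hc ha a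
  rw [← inner_pinv_apply_left, h, zero_mul] at h1
  exact inner_self_eq_zero.1 (pow_eq_zero_iff two_ne_zero |>.1 (le_antisymm h1 (sq_nonneg _)))

theorem abs_inner_error_le (hA : ∀ f : Vec d → ℝ, ∑ i, f (A i) = ∑ a ∈ S, c a * f a)
    (hAS : ∀ i, A i ∈ S) (hc : ∀ b ∈ S, 0 ≤ c b)
    (hr : ∀ a ∈ S, a ∈ LinearMap.range (Matrix.toEuclideanLin (designMatrix S c)))
    {θ φ : Vec d} {ω ρ σ l : ℝ} (hρ : 0 ≤ ρ) (hσ : 0 < σ) (hl : 0 ≤ l)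
    (hv : ∀ a ∈ S, link ω (inner ℝ φ a) ≤ σ ^ 2) {e : ι → ℝ}
    (he : NoiseControlled S c A (fun i => link ω (inner ℝ φ (A i))) σ l e)
    {θ' φ' : Vec d}
    (hθ : θ' = Matrix.toEuclideanLin (pinv (designMatrix S c))
      (∑ i, (inner ℝ (A i) θ + e i) • A i))
    (hφ : φ' = Matrix.toEuclideanLin (pinv (designMatrix S c))
      (∑ i, linkInv ω ((inner ℝ (A i) θ + e i - inner ℝ θ' (A i)) ^ 2) • A i))
    {a : Vec d} (ha : a ∈ S) (hd : 2 ≤ d) :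
    |inner ℝ (ρ • θ - φ - (ρ • θ' - φ')) a|
      ≤ √(inner ℝ (Matrix.toEuclideanLin (pinv (designMatrix S c)) a) a)
        * (ρ * (σ * √(2 * l)) + σ ^ 2 * d * (8 * l + 5)) := by
  rcases eq_or_ne a 0 with rfl | h0
  · simp
  have hθerr : ∀ b ∈ S, inner ℝ θ' b = inner ℝ θ b
      + ∑ i, inner ℝ (A i) (Matrix.toEuclideanLin (pinv (designMatrix S c)) b) * e i := by
    intro b hb
    rw [hθ, inner_least_squares hA (hr b hb) _ θ]
    congr 1
    exact Finset.sum_congr rfl fun i _ => by ring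
  have hΔ : ∀ b ∈ S, |inner ℝ θ b - inner ℝ θ' b|
      ≤ σ * √(inner ℝ (Matrix.toEuclideanLin (pinv (designMatrix S c)) b) b) * √(2 * l) := by
    intro b hb
    rcases eq_or_ne b 0 with rfl | hb0
    · simp
    · rw [hθerr b hb, sub_add_cancel_left, abs_neg]
      exact (he b hb hb0 _ rfl).1
  have hΔsum : ∑ i, (inner ℝ θ (A i) - inner ℝ θ' (A i)) ^ 2 ≤ 2 * l * σ ^ 2 * d := by
    calc _ ≤ ∑ i, 2 * l * σ ^ 2
            * inner ℝ (Matrix.toEuclideanLin (pinv (designMatrix S c)) (A i)) (A i) := by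
          refine Finset.sum_le_sum fun i _ => ?_
          have h := pow_le_pow_left₀ (abs_nonneg _) (hΔ (A i) (hAS i)) 2
          rw [sq_abs, mul_pow, mul_pow, Real.sq_sqrt (inner_pinv_nonneg hc (hr _ (hAS i))),
            Real.sq_sqrt (by positivity)] at h
          linarith
      _ ≤ 2 * l * σ ^ 2 * d := by
          rw [← Finset.mul_sum]
          refine mul_le_mul_of_nonneg_left ?_ (by positivity)
          rw [hA fun b => inner ℝ (Matrix.toEuclideanLin (pinv (designMatrix S c)) b) b]
          simp only [inner_pinv_apply_left]
          exact sum_inner_pinv_le S c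
  obtain ⟨N, hNdef⟩ :
      ∃ N, N = √(inner ℝ (Matrix.toEuclideanLin (pinv (designMatrix S c)) a) a) := ⟨_, rfl⟩
  have hq := inner_pinv_pos hc (hr a ha) h0
  have hN : 0 < N := hNdef ▸ Real.sqrt_pos.2 hq
  obtain ⟨-, h1, h2⟩ := he a ha h0 _ rfl
  have hw : ∑ i, inner ℝ (A i) (Matrix.toEuclideanLin (pinv (designMatrix S c)) a) ^ 2
      = N ^ 2 := by
    rw [hNdef, Real.sq_sqrt hq.le, ← sum_inner_mul_inner_pinv hA (hr a ha)]
    exact Finset.sum_congr rfl fun i _ => sq _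
  rw [← hNdef] at h1 h2 ⊢
  have hφerr : |inner ℝ φ' a - inner ℝ φ a| ≤ σ ^ 2 * N * (8 * l + 9)
      + 2 * N * (2 * l * σ ^ 2 * d) := by
    rw [hφ, inner_least_squares hA (hr a ha) _ φ, add_sub_cancel_left]
    refine le_trans (le_of_eq ?_)
      (abs_sum_mul_sq_add_sub_le hN hw (fun i => hv _ (hAS i)) h1 h2 hΔsum)
    congr 1
    refine Finset.sum_congr rfl fun i _ => ?_
    rw [linkInv, link, real_inner_comm θ (A i), real_inner_comm φ (A i)]
    ring
  have hθa := hΔ a ha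
  rw [← hNdef] at hθa
  have hd' : (2 : ℝ) ≤ d := by exact_mod_cast hd
  have hsplit : inner ℝ (ρ • θ - φ - (ρ • θ' - φ')) a
      = ρ * (inner ℝ θ a - inner ℝ θ' a) + (inner ℝ φ' a - inner ℝ φ a) := by
    simp only [inner_sub_left, real_inner_smul_left]
    ring
  rw [hsplit]
  refine (abs_add_le _ _).trans ?_
  rw [abs_mul, abs_of_nonneg hρ]
  have hA1 := mul_le_mul_of_nonneg_left hθa hρ
  -- Here d ≥ 2 absorbs the constant: 8l + 9 ≤ 2(4l + 5). Together with 4ld from the Δ-term this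
  -- yields d(8l + 5).
  have hA2 : σ ^ 2 * N * (8 * l + 9) ≤ σ ^ 2 * N * (d * (4 * l + 5)) := by
    gcongr
    nlinarith
  linarith

end

section

/-! ### Tail bounds for independent Gaussian variables -/

theorem integral_exp_sq_gaussianReal {v : NNReal} {s : ℝ} (hs : 2 * s * v < 1) :
    Integrable (fun x : ℝ => Real.exp (s * x ^ 2)) (gaussianReal 0 v) ∧
      ∫ x, Real.exp (s * x ^ 2) ∂gaussianReal 0 v = (√(1 - 2 * s * v))⁻¹ := by
  rcases eq_or_ne v 0 with rfl | hv
  · simp [gaussianReal_zero_var, integrable_dirac]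
  have hv0 : (0 : ℝ) < v := lt_of_le_of_ne v.2 (by exact_mod_cast hv.symm)
  have hb : 0 < (1 - 2 * s * v) / (2 * v) := div_pos (by linarith) (by linarith)
  have hfun : ∀ x : ℝ, gaussianPDFReal 0 v x * Real.exp (s * x ^ 2)
      = (√(2 * Real.pi * v))⁻¹ * Real.exp (-((1 - 2 * s * v) / (2 * v)) * x ^ 2) := by
    intro x
    rw [gaussianPDFReal, mul_assoc, ← Real.exp_add]
    congr 2
    field_simp
    ring
  constructor
  · rw [gaussianReal_of_var_ne_zero _ hv, integrable_withDensity_iff (measurable_gaussianPDF _ _)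
      (Filter.Eventually.of_forall fun _ => gaussianPDF_lt_top)]
    refine ((integrable_exp_neg_mul_sq hb).const_mul (√(2 * Real.pi * v))⁻¹).congr
      (Filter.Eventually.of_forall fun x => ?_)
    simp only [toReal_gaussianPDF]
    rw [← hfun x, mul_comm]
  · rw [integral_gaussianReal_eq_integral_smul hv]
    simp only [smul_eq_mul, hfun]
    rw [integral_const_mul, integral_gaussian, ← Real.sqrt_inv, ← Real.sqrt_inv,
      ← Real.sqrt_mul (by positivity)]
    congr 1
    have : (1 - 2 * s * v) ≠ 0 := by linarith
    field_simp

/-- Second-order Taylor bound for -log(1 - x). The left side is the moment generating function of a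
centered squared Gaussian, with x = 2sv. -/
theorem exp_mul_inv_sqrt_le {x : ℝ} (hx : |x| ≤ 1 / 2) :
    Real.exp (-x / 2) * (√(1 - x))⁻¹ ≤ Real.exp (x ^ 2) := by
  obtain ⟨h1, h2⟩ := abs_le.1 hx
  have hpos : 0 < 1 - x := by linarith
  have hlog : -Real.log (1 - x) ≤ x + 3 / 2 * x ^ 2 := by
    have h := (abs_le.1 (Real.abs_log_sub_add_sum_range_le (x := x) (by linarith) 2)).1
    simp only [Finset.sum_range_succ, Finset.sum_range_zero, Nat.cast_zero, Nat.cast_one, zero_add,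
      pow_one, div_one] at h
    have h3 : |x| ^ (2 + 1) / (1 - |x|) ≤ x ^ 2 := by
      rw [div_le_iff₀ (by linarith), pow_succ, sq_abs]
      nlinarith [sq_nonneg x]
    norm_num at h h3
    linarith
  rw [Real.sqrt_eq_rpow, ← Real.rpow_neg hpos.le, Real.rpow_def_of_pos hpos, ← Real.exp_add,
    Real.exp_le_exp]
  nlinarith [sq_nonneg x]

variable {Ω : Type*} [MeasurableSpace Ω] {μ : Measure Ω}

theorem hasSubgaussianMGF_of_map_eq_gaussianReal [IsProbabilityMeasure μ] {X : Ω → ℝ}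
    (hX : Measurable X) {v c : NNReal} (hlaw : μ.map X = gaussianReal 0 v) (hvc : v ≤ c) :
    HasSubgaussianMGF X c μ where
  integrable_exp_mul t := by
    have h := integrable_exp_mul_gaussianReal (μ := 0) (v := v) t
    rw [← hlaw] at h
    exact h.comp_measurable hX
  mgf_le t := by
    rw [mgf_gaussianReal hlaw, zero_mul, zero_add]
    gcongr

theorem measureReal_exp_le_of_mgf_le [IsProbabilityMeasure μ] {X : Ω → ℝ} {s ε c : ℝ} (hs : 0 ≤ s)
    (hint : Integrable (fun w => Real.exp (s * X w)) μ) (hmgf : mgf X μ s ≤ Real.exp c) :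
    μ.real {w | ε ≤ X w} ≤ Real.exp (c - s * ε) := by
  refine (measure_ge_le_exp_mul_mgf ε hs hint).trans ?_
  rw [sub_eq_neg_add, Real.exp_add, neg_mul]
  gcongr

theorem mgf_centered_sq_le [IsProbabilityMeasure μ] {X : Ω → ℝ}
    (hX : Measurable X) {v : NNReal} (hlaw : μ.map X = gaussianReal 0 v) {s : ℝ}
    (hs : |2 * s * v| ≤ 1 / 2) :
    Integrable (fun w => Real.exp (s * (X w ^ 2 - v))) μ ∧
      mgf (fun w => X w ^ 2 - v) μ s ≤ Real.exp ((2 * s * v) ^ 2) := by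
  have hfun : ∀ x : ℝ, Real.exp (s * (x ^ 2 - v))
      = Real.exp (-(2 * s * v) / 2) * Real.exp (s * x ^ 2) := fun x => by
    rw [← Real.exp_add]; congr 1; ring
  obtain ⟨h1, h2⟩ := integral_exp_sq_gaussianReal (v := v) (s := s)
    (by linarith [(abs_le.1 hs).2])
  rw [← hlaw] at h1 h2
  rw [integral_map hX.aemeasurable (by fun_prop)] at h2
  refine ⟨?_, ?_⟩
  · simp only [hfun]
    exact (h1.comp_measurable hX).const_mul _
  · simp only [mgf, hfun]
    rw [integral_const_mul, h2]
    exact exp_mul_inv_sqrt_le hs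

variable {ι : Type*} [Fintype ι]

theorem measureReal_sum_mul_ge_le [IsProbabilityMeasure μ] {X : ι → Ω → ℝ}
    (hX : ∀ i, Measurable (X i)) (hind : iIndepFun X μ) {v : ι → NNReal}
    (hlaw : ∀ i, μ.map (X i) = gaussianReal 0 (v i)) {σ : ℝ} (hσ : 0 < σ)
    (hv : ∀ i, (v i : ℝ) ≤ σ ^ 2) (u : ι → ℝ) {N : ℝ} (hN : 0 < N) (hu : ∑ i, u i ^ 2 ≤ N ^ 2)
    {l : ℝ} (hl : 0 ≤ l) :
    μ.real {w | σ * N * √(2 * l) ≤ ∑ i, u i * X i w} ≤ Real.exp (-l) := by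
  have hsub : ∀ i, HasSubgaussianMGF (fun w => u i * X i w)
      (⟨u i ^ 2, sq_nonneg _⟩ * ⟨σ ^ 2, sq_nonneg _⟩) μ := fun i =>
    (hasSubgaussianMGF_of_map_eq_gaussianReal (hX i) (hlaw i)
      (c := ⟨σ ^ 2, sq_nonneg _⟩) (hv i)).const_mul (u i)
  have hs : σ * N > 0 := by positivity
  have hind' : iIndepFun (fun i w => u i * X i w) μ :=
    hind.comp (fun i x => u i * x) fun i => by fun_prop
  -- √(2l)/(σN) is the optimal Chernoff parameter for a sub-Gaussian variable with proxy (σN)².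
  have hint : Integrable (fun w => Real.exp (√(2 * l) / (σ * N) * ∑ i, u i * X i w)) μ :=
    (HasSubgaussianMGF.sum_of_iIndepFun hind' (s := Finset.univ) fun i _ => hsub i)
      |>.integrable_exp_mul _
  have hmgf : mgf (fun w => ∑ i, u i * X i w) μ (√(2 * l) / (σ * N)) ≤ Real.exp l := by
    refine (HasSubgaussianMGF.mgf_le (HasSubgaussianMGF.sum_of_iIndepFun hind'
      (s := Finset.univ) fun i _ => hsub i) _).trans (Real.exp_le_exp.2 ?_)
    rw [div_pow, Real.sq_sqrt (by positivity), NNReal.coe_sum]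
    have : ∑ i, ((⟨u i ^ 2, sq_nonneg _⟩ * ⟨σ ^ 2, sq_nonneg _⟩ : NNReal) : ℝ)
        ≤ (σ * N) ^ 2 := by
      have hcoe : ∀ i, ((⟨u i ^ 2, sq_nonneg _⟩ * ⟨σ ^ 2, sq_nonneg _⟩ : NNReal) : ℝ)
          = u i ^ 2 * σ ^ 2 := fun i => rfl
      simp only [hcoe]
      rw [← Finset.sum_mul, mul_pow, mul_comm]
      gcongr
    calc _ ≤ (σ * N) ^ 2 * (2 * l / (σ * N) ^ 2) / 2 := by gcongr
      _ = l := by field_simp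
  refine (measureReal_exp_le_of_mgf_le (by positivity) hint hmgf).trans (le_of_eq ?_)
  have : √(2 * l) / (σ * N) * (σ * N * √(2 * l)) = √(2 * l) * √(2 * l) := by field_simp
  rw [this, Real.mul_self_sqrt (by positivity)]
  congr 1
  ring

theorem measureReal_sum_sq_ge_le [IsProbabilityMeasure μ] {X : ι → Ω → ℝ}
    (hX : ∀ i, Measurable (X i)) (hind : iIndepFun X μ) {v : ι → NNReal}
    (hlaw : ∀ i, μ.map (X i) = gaussianReal 0 (v i)) {σ : ℝ} (hσ : 0 < σ)
    (hv : ∀ i, (v i : ℝ) ≤ σ ^ 2) (u : ι → ℝ) {N : ℝ} (hN : 0 < N) (hu : ∑ i, u i ^ 2 ≤ N ^ 2)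
    (l : ℝ) :
    μ.real {w | 4 * σ ^ 2 * N * (l + 1) ≤ ∑ i, u i * (X i w ^ 2 - v i)} ≤ Real.exp (-l) := by
  -- This Chernoff parameter keeps every |2 s u_i v_i| at most |u_i|/(2N) ≤ 1/2, the range of
  -- `exp_mul_inv_sqrt_le`. The total exponent is then at most 1/4, bounded by 1, which the summand
  -- 1 in l + 1 pays for.
  set s : ℝ := 1 / (4 * σ ^ 2 * N) with hs
  have hs0 : 0 < s := by positivity
  have hsmall : ∀ i, |2 * (s * u i) * v i| ≤ |u i| / (2 * N) := by
    intro i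
    rw [abs_mul, abs_mul, abs_mul, abs_two, abs_of_pos hs0, NNReal.abs_eq]
    calc 2 * (s * |u i|) * (v i : ℝ) ≤ 2 * (s * |u i|) * σ ^ 2 := by gcongr; exact hv i
      _ = |u i| / (2 * N) := by rw [hs]; field_simp; ring
  have huN : ∀ i, |u i| ≤ N := fun i => by
    rw [← abs_of_pos hN]
    exact sq_le_sq.1 ((Finset.single_le_sum (f := fun i => u i ^ 2) (fun j _ => sq_nonneg _)
      (Finset.mem_univ i)).trans hu)
  have hhalf : ∀ i, |2 * (s * u i) * v i| ≤ 1 / 2 := fun i => (hsmall i).trans (by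
    rw [div_le_div_iff₀ (by positivity) two_pos]; linarith [huN i])
  have hY : ∀ i, Measurable fun w => u i * (X i w ^ 2 - v i) := fun i => by
    have := hX i; fun_prop
  have hind' : iIndepFun (fun i w => u i * (X i w ^ 2 - v i)) μ :=
    hind.comp (fun i x => u i * (x ^ 2 - v i)) fun i => by fun_prop
  have hint1 : ∀ i, Integrable (fun w => Real.exp (s * (u i * (X i w ^ 2 - v i)))) μ := fun i => by
    simpa only [mul_assoc] using (mgf_centered_sq_le (hX i) (hlaw i) (hhalf i)).1
  have hmgf1 : ∀ i, mgf (fun w => u i * (X i w ^ 2 - v i)) μ s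
      ≤ Real.exp (u i ^ 2 / (4 * N ^ 2)) := fun i => by
    have h1 := (mgf_centered_sq_le (hX i) (hlaw i) (hhalf i)).2
    have h2 : mgf (fun w => u i * (X i w ^ 2 - v i)) μ s
        = mgf (fun w => X i w ^ 2 - v i) μ (s * u i) := by
      simp only [mgf, mul_assoc]
    rw [h2]
    refine h1.trans (Real.exp_le_exp.2 ?_)
    rw [← sq_abs]
    calc _ ≤ (|u i| / (2 * N)) ^ 2 := by gcongr; exact hsmall i
      _ = u i ^ 2 / (4 * N ^ 2) := by rw [div_pow, sq_abs]; ring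
  have hsum : (fun w => ∑ i, u i * (X i w ^ 2 - v i))
      = ∑ i, fun w => u i * (X i w ^ 2 - v i) := by
    ext w; simp
  have hint : Integrable (fun w => Real.exp (s * ∑ i, u i * (X i w ^ 2 - v i))) μ := by
    have := hind'.integrable_exp_mul_sum (t := s) hY (s := Finset.univ) fun i _ => hint1 i
    simpa using this
  have hmgf : mgf (fun w => ∑ i, u i * (X i w ^ 2 - v i)) μ s ≤ Real.exp 1 := by
    rw [hsum, hind'.mgf_sum hY]
    calc _ ≤ ∏ i, Real.exp (u i ^ 2 / (4 * N ^ 2)) :=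
          Finset.prod_le_prod (fun i _ => mgf_nonneg) fun i _ => hmgf1 i
      _ = Real.exp (∑ i, u i ^ 2 / (4 * N ^ 2)) := (Real.exp_sum _ _).symm
      _ ≤ Real.exp 1 := by
          rw [Real.exp_le_exp, ← Finset.sum_div, div_le_one (by positivity)]
          nlinarith
  refine (measureReal_exp_le_of_mgf_le hs0.le hint hmgf).trans (le_of_eq ?_)
  congr 1
  rw [hs]
  field_simp
  ring

theorem measureReal_abs_ge_le {Y : Ω → ℝ} {x p q : ℝ} [IsFiniteMeasure μ]
    (h1 : μ.real {w | x ≤ Y w} ≤ p) (h2 : μ.real {w | x ≤ -Y w} ≤ q) :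
    μ.real {w | x ≤ |Y w|} ≤ p + q := by
  have : {w | x ≤ |Y w|} = {w | x ≤ Y w} ∪ {w | x ≤ -Y w} := by
    ext w; simp [le_abs]
  rw [this]
  exact (measureReal_union_le _ _).trans (add_le_add h1 h2)

end

/-! ### The phases of the algorithm -/

namespace Input

variable {I : Input d}

/-- The factor by which a phase multiplies the normalized design. -/
noncomputable def scale (I : Input d) (ℓ : ℕ) : ℝ :=
  I.Chat ^ 2 * d ^ 2 * Real.log d * Real.log ((I.actions.card : ℝ) * I.T / I.δ) ^ 2 / tol ℓ ^ 2

theorem scale_mul_le_plays (ℓ : ℕ) (S : Finset (Vec d)) (a : Vec d) :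
    I.scale ℓ * (gValue S (I.design ℓ S)).toReal * I.design ℓ S a ≤ I.plays ℓ S a := by
  refine le_trans (le_of_eq ?_) (Nat.le_ceil _)
  rw [scale]
  ring

/-- The factor g(Q) from the G-criterion cancels the one in the number of plays; rounding up only
enlarges V. -/
theorem sq_inner_le_phaseMatrix (hI : I.Valid) {ℓ : ℕ} (hℓ : 1 ≤ ℓ) {S : Finset (Vec d)}
    (hS : S ⊆ I.actions) (hne : S.Nonempty) (hscale : 0 < I.scale ℓ) {a : Vec d} (ha : a ∈ S)
    (x : Vec d) :
    inner ℝ a x ^ 2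
      ≤ (I.scale ℓ)⁻¹ * inner ℝ x (Matrix.toEuclideanLin (I.phaseMatrix ℓ S) x) := by
  have hopt := (hI ℓ hℓ S hS hne).1
  refine (sq_inner_le_gValue hopt.1 (hopt.gValue_ne_top hne) ha x).trans ?_
  rw [phaseMatrix, inner_designMatrix, le_inv_mul_iff₀ hscale, ← mul_assoc, Finset.mul_sum]
  refine Finset.sum_le_sum fun b _ => ?_
  rw [← mul_assoc, ← sq]
  exact mul_le_mul_of_nonneg_right (scale_mul_le_plays ℓ S b) (sq_nonneg _)

theorem mem_of_mem_schedule (hI : I.Valid) {ℓ : ℕ} (hℓ : 1 ≤ ℓ) {S : Finset (Vec d)}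
    (hS : S ⊆ I.actions) (hne : S.Nonempty) {a : Vec d} (ha : a ∈ I.schedule ℓ S) : a ∈ S := by
  classical
  by_contra h
  have h1 := (hI ℓ hℓ S hS hne).2 a
  rw [if_neg h] at h1
  exact (List.count_pos_iff.2 ha).ne' (by convert h1)

theorem sum_schedule (hI : I.Valid) {ℓ : ℕ} (hℓ : 1 ≤ ℓ) {S : Finset (Vec d)}
    (hS : S ⊆ I.actions) (hne : S.Nonempty) (f : Vec d → ℝ) :
    ∑ i : Fin (I.schedule ℓ S).length, f ((I.schedule ℓ S).get i)
      = ∑ a ∈ S, (I.plays ℓ S a : ℝ) * f a := by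
  classical
  have hcount : ∀ a ∈ S, (I.schedule ℓ S).count a = I.plays ℓ S a := fun a ha => by
    have := (hI ℓ hℓ S hS hne).2 a
    rw [if_pos ha] at this
    convert this
  have h1 : ∑ i : Fin (I.schedule ℓ S).length, f ((I.schedule ℓ S).get i)
      = ((I.schedule ℓ S).map f).sum := by
    rw [← List.sum_ofFn]
    congr 1
    conv_rhs => rw [← List.ofFn_get (I.schedule ℓ S), List.map_ofFn]
    rfl
  rw [h1, Finset.sum_list_map_count]
  have hsub : (I.schedule ℓ S).toFinset ⊆ S := fun a ha =>
    mem_of_mem_schedule hI hℓ hS hne (List.mem_toFinset.1 ha)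
  rw [Finset.sum_subset hsub fun a _ ha => by
    rw [List.count_eq_zero.2 (by simpa using ha), zero_smul]]
  exact Finset.sum_congr rfl fun a ha => by rw [hcount a ha, nsmul_eq_mul]

/-- An empty schedule means V = 0, and then the form inequality forces a = 0. The zero action must
be excluded: for S = {0} no play is prescribed. -/
theorem schedule_length_pos (hI : I.Valid) {ℓ : ℕ} (hℓ : 1 ≤ ℓ) {S : Finset (Vec d)}
    (hS : S ⊆ I.actions) (hscale : 0 < I.scale ℓ) {a : Vec d} (ha : a ∈ S) (h0 : a ≠ 0) :
    0 < (I.schedule ℓ S).length := by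
  have hne : S.Nonempty := ⟨a, ha⟩
  by_contra! hlen
  have hnil : I.schedule ℓ S = [] := List.eq_nil_of_length_eq_zero (by omega)
  have h1 := sq_inner_le_phaseMatrix hI hℓ hS hne hscale ha a
  have h2 := sum_schedule hI hℓ hS hne fun b => inner ℝ b a * inner ℝ b a
  rw [phaseMatrix, inner_designMatrix, ← h2, Finset.sum_eq_zero, mul_zero] at h1
  · exact h0 (inner_self_eq_zero.1
      (pow_eq_zero_iff two_ne_zero |>.1 (le_antisymm h1 (sq_nonneg _))))
  · intro i _
    have := i.2
    omega

theorem survivors_subset (r : ℕ → Vec d → ℝ) (ℓ s : ℕ) (S : Finset (Vec d)) :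
    I.survivors r ℓ s S ⊆ S := Finset.filter_subset _ _

/-- A maximizer of the estimated objective is never eliminated. -/
theorem survivors_nonempty (r : ℕ → Vec d → ℝ) (ℓ s : ℕ) {S : Finset (Vec d)}
    (hS : S.Nonempty) : (I.survivors r ℓ s S).Nonempty := by
  obtain ⟨a, ha, hmax⟩ := S.exists_max_image
    (fun b => inner ℝ (I.ρ • I.thetaHat r ℓ s S - I.phiHat r ℓ s S) b) hS
  refine ⟨a, Finset.mem_filter.2 ⟨ha, fun b hb => ?_⟩⟩
  rw [inner_sub_right]
  have : 0 < tol ℓ := by unfold tol; positivity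
  linarith [hmax b hb]

theorem startTime_add_two (r : ℕ → Vec d → ℝ) (ℓ : ℕ) :
    I.startTime r (ℓ + 2)
      = I.startTime r (ℓ + 1) + (I.schedule (ℓ + 1) (I.active r (ℓ + 1))).length := rfl

theorem active_subset (r : ℕ → Vec d → ℝ) (ℓ : ℕ) : I.active r (ℓ + 1) ⊆ I.actions := by
  induction ℓ with
  | zero => exact Finset.Subset.refl _
  | succ k ih => exact (survivors_subset _ _ _ _).trans ih

theorem active_nonempty (h : I.actions.Nonempty) (r : ℕ → Vec d → ℝ) (ℓ : ℕ) :
    (I.active r (ℓ + 1)).Nonempty := by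
  induction ℓ with
  | zero => exact h
  | succ k ih => exact survivors_nonempty _ _ _ ih

theorem le_startTime (hI : I.Valid) (hscale : ∀ ℓ, 0 < I.scale ℓ) (r : ℕ → Vec d → ℝ) (ℓ : ℕ)
    {a : Vec d} (ha : a ∈ I.active r (ℓ + 1)) (h0 : a ≠ 0) : ℓ ≤ I.startTime r (ℓ + 1) := by
  induction ℓ with
  | zero => exact Nat.zero_le _
  | succ k ih =>
    -- Active sets decrease, so a was active in every earlier phase and each of them took a round.
    have ha' := survivors_subset _ _ _ _ ha
    have h1 := ih ha'
    have h2 := schedule_length_pos hI (Nat.succ_pos k) (active_subset r k) (hscale _) ha' h0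
    rw [startTime_add_two]
    unfold active at h2 ⊢
    simp only [Nat.succ_eq_add_one] at h2
    omega

theorem Completed.le_horizon (hI : I.Valid) (hscale : ∀ ℓ, 0 < I.scale ℓ) {r : ℕ → Vec d → ℝ}
    {ℓ : ℕ} (h : I.Completed r (ℓ + 1)) {a : Vec d} (ha : a ∈ I.active r (ℓ + 1)) (h0 : a ≠ 0) :
    ℓ < I.T := by
  have h1 := le_startTime hI hscale r ℓ ha h0
  have h2 := schedule_length_pos hI (Nat.succ_pos ℓ) (active_subset r ℓ) (hscale _) ha h0
  unfold Completed at h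
  simp only [Nat.succ_eq_add_one] at h2
  omega

/-! ### Measurability of the phases -/

section Measurability

variable {Ω : Type*} {r : Ω → ℕ → Vec d → ℝ}

theorem measurable_thetaHat {m : MeasurableSpace Ω} {ℓ s : ℕ} {S : Finset (Vec d)}
    (hr : ∀ i : Fin (I.schedule ℓ S).length,
      Measurable fun w => r w (s + i) ((I.schedule ℓ S).get i)) :
    Measurable fun w => I.thetaHat (r w) ℓ s S := by
  unfold thetaHat
  refine (LinearMap.continuous_of_finiteDimensional _).measurable.comp ?_
  exact Finset.measurable_sum _ fun i _ => (hr i).smul_const _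

theorem measurable_phiHat {m : MeasurableSpace Ω} {ℓ s : ℕ} {S : Finset (Vec d)}
    (hr : ∀ i : Fin (I.schedule ℓ S).length,
      Measurable fun w => r w (s + i) ((I.schedule ℓ S).get i)) :
    Measurable fun w => I.phiHat (r w) ℓ s S := by
  unfold phiHat linkInv
  refine (LinearMap.continuous_of_finiteDimensional _).measurable.comp ?_
  refine Finset.measurable_sum _ fun i _ => Measurable.smul_const ?_ _
  exact (((hr i).sub ((measurable_thetaHat hr).inner measurable_const)).pow_const 2).sub_const _

theorem measurableSet_survivors_eq {m : MeasurableSpace Ω} {ℓ s : ℕ} {S : Finset (Vec d)}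
    (hr : ∀ i : Fin (I.schedule ℓ S).length,
      Measurable fun w => r w (s + i) ((I.schedule ℓ S).get i)) (S' : Finset (Vec d)) :
    MeasurableSet {w | I.survivors (r w) ℓ s S = S'} := by
  have hP : ∀ a, MeasurableSet {w | ∀ b ∈ S,
      inner ℝ (I.ρ • I.thetaHat (r w) ℓ s S - I.phiHat (r w) ℓ s S) (b - a) ≤ 2 * tol ℓ} := by
    intro a
    have hv : Measurable fun w => I.ρ • I.thetaHat (r w) ℓ s S - I.phiHat (r w) ℓ s S :=
      ((measurable_thetaHat hr).const_smul I.ρ).sub (measurable_phiHat hr)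
    have hset : {w | ∀ b ∈ S, inner ℝ (I.ρ • I.thetaHat (r w) ℓ s S - I.phiHat (r w) ℓ s S) (b - a)
          ≤ 2 * tol ℓ}
        = ⋂ b ∈ S, {w | inner ℝ (I.ρ • I.thetaHat (r w) ℓ s S - I.phiHat (r w) ℓ s S) (b - a)
          ≤ 2 * tol ℓ} := by
      ext w
      simp only [Set.mem_iInter, Set.mem_ofPred_eq]
    rw [hset]
    exact Finset.measurableSet_biInter _ fun b _ =>
      measurableSet_le (hv.inner measurable_const) measurable_const
  have hset : {w | I.survivors (r w) ℓ s S = S'}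
      = {_w | S' ⊆ S} ∩ ⋂ a ∈ S, {w | (∀ b ∈ S,
        inner ℝ (I.ρ • I.thetaHat (r w) ℓ s S - I.phiHat (r w) ℓ s S) (b - a) ≤ 2 * tol ℓ)
          ↔ a ∈ S'} := by
    ext w
    simp only [survivors, Finset.ext_iff, Finset.mem_filter, Set.mem_ofPred_eq, Set.mem_inter_iff,
      Set.mem_iInter, Finset.subset_iff]
    constructor
    · exact fun h => ⟨fun a ha => ((h a).2 ha).1, fun a ha => by rw [← h a]; simp [ha]⟩
    · rintro ⟨h1, h2⟩ a
      exact ⟨fun ⟨ha, hb⟩ => (h2 a ha).1 hb, fun ha => ⟨h1 ha, (h2 a (h1 ha)).2 ha⟩⟩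
  rw [hset]
  refine (MeasurableSet.const _).inter (Finset.measurableSet_biInter _ fun a _ => ?_)
  by_cases ha : a ∈ S'
  · simpa only [ha, iff_true] using hP a
  · simp only [ha, iff_false]
    exact (hP a).compl

/-- The state of a phase is a function of the rewards observed before its start. -/
theorem measurableSet_phase_eq (hI : I.Valid) (hne : I.actions.Nonempty)
    {m : ℕ → MeasurableSpace Ω}
    (hr : ∀ t, ∀ a ∈ I.actions, Measurable[m t] fun w => r w t a) (ℓ s : ℕ)
    (S : Finset (Vec d)) :
    MeasurableSet[⨆ t ∈ Set.Iio s, m t] {w | I.phase (r w) (ℓ + 1) = (s, S)} := by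
  induction ℓ generalizing s S with
  | zero => exact @MeasurableSet.const _ (⨆ t ∈ Set.Iio s, m t) ((0, I.actions) = (s, S))
  | succ k ih =>
    -- Split over the finitely many possible previous states. Nonemptiness is carried along because
    -- `Valid` constrains schedules of nonempty sets only.
    have hset : {w | I.phase (r w) (k + 1 + 1) = (s, S)}
        = ⋃ p ∈ Finset.range (s + 1) ×ˢ I.actions.powerset,
          {w | I.phase (r w) (k + 1) = p} ∩ ({_w | p.1 + (I.schedule (k + 1) p.2).length = s
            ∧ p.2.Nonempty} ∩ {w | I.survivors (r w) (k + 1) p.1 p.2 = S}) := by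
      ext w
      simp only [Set.mem_ofPred_eq, Set.mem_iUnion, Set.mem_inter_iff, Finset.mem_product,
        Finset.mem_range, Finset.mem_powerset, exists_prop]
      constructor
      · intro h
        have h' := Prod.ext_iff.1 h
        refine ⟨I.phase (r w) (k + 1), ⟨?_, active_subset _ k⟩, rfl,
          ⟨h'.1, active_nonempty hne _ k⟩, h'.2⟩
        have : I.startTime (r w) (k + 2) = s := h'.1
        rw [startTime_add_two] at this
        change I.startTime (r w) (k + 1) < s + 1
        omega
      · rintro ⟨p, -, rfl, ⟨h1, -⟩, h2⟩
        exact Prod.ext h1 h2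
    rw [hset]
    refine Finset.measurableSet_biUnion _ fun p hp => ?_
    rw [Finset.mem_product, Finset.mem_powerset] at hp
    by_cases hs : p.1 + (I.schedule (k + 1) p.2).length = s ∧ p.2.Nonempty
    · have hle : (⨆ t ∈ Set.Iio p.1, m t) ≤ ⨆ t ∈ Set.Iio s, m t :=
        biSup_mono fun t (ht : t < p.1) => show t < s by omega
      refine MeasurableSet.inter (hle _ (ih p.1 p.2))
        (MeasurableSet.inter (MeasurableSet.const _) (measurableSet_survivors_eq ?_ S))
      intro i
      have hlt : p.1 + (i : ℕ) < s := by have := i.2; omega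
      have hmem := hp.2 (mem_of_mem_schedule hI (Nat.succ_pos k) hp.2 hs.2
        (List.get_mem (I.schedule (k + 1) p.2) i))
      exact (hr _ _ hmem).mono (le_iSup₂ (f := fun t (_ : t ∈ Set.Iio s) => m t) _ hlt) le_rfl
    · simp only [hs, Set.ofPred_false, Set.empty_inter, Set.inter_empty, MeasurableSet.empty]

end Measurability

end Input

/-! ### The noise of one phase -/

section Deviation

variable {Ω : Type*} {ι : Type*} [Fintype ι]

/-- The event that the linear or the quadratic noise terms with weights `u` deviate. -/
def deviationEvent (X : ι → Ω → ℝ) (v u : ι → ℝ) (σ N l : ℝ) : Set Ω :=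
  {w | σ * N * √(2 * l) ≤ |∑ i, u i * X i w|} ∪
    ({w | 4 * σ ^ 2 * N * (l + 1) ≤ |∑ i, u i * (X i w ^ 2 - v i)|} ∪
      {w | 4 * σ ^ 2 * N ^ 2 * (l + 1) ≤ ∑ i, u i ^ 2 * (X i w ^ 2 - v i)})

theorem measurableSet_deviationEvent {m : MeasurableSpace Ω} {X : ι → Ω → ℝ}
    (hX : ∀ i, Measurable (X i)) (v u : ι → ℝ) (σ N l : ℝ) :
    MeasurableSet (deviationEvent X v u σ N l) := by
  refine MeasurableSet.union ?_ (MeasurableSet.union ?_ ?_)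
  · exact measurableSet_le measurable_const (by fun_prop)
  · exact measurableSet_le measurable_const (by fun_prop)
  · exact measurableSet_le measurable_const (by fun_prop)

/-- The factor 5 counts tails: two linear, two quadratic, and one for the weights u², where ∑ u⁴ ≤
(∑ u²)² allows N² as norm bound. -/
theorem measureReal_deviationEvent_le [MeasurableSpace Ω] {μ : Measure Ω} [IsProbabilityMeasure μ]
    {X : ι → Ω → ℝ} (hX : ∀ i, Measurable (X i)) (hind : iIndepFun X μ) {v : ι → ℝ}
    (hv0 : ∀ i, 0 ≤ v i) (hlaw : ∀ i, μ.map (X i) = gaussianReal 0 (v i).toNNReal) {σ : ℝ}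
    (hσ : 0 < σ) (hv : ∀ i, v i ≤ σ ^ 2) {u : ι → ℝ} {N : ℝ} (hN : 0 < N)
    (hu : ∑ i, u i ^ 2 = N ^ 2) {l : ℝ} (hl : 0 ≤ l) :
    μ.real (deviationEvent X v u σ N l) ≤ 5 * Real.exp (-l) := by
  have hcoe : ∀ i, ((v i).toNNReal : ℝ) = v i := fun i => Real.coe_toNNReal _ (hv0 i)
  have hv' : ∀ i, ((v i).toNNReal : ℝ) ≤ σ ^ 2 := fun i => (hcoe i).trans_le (hv i)
  have hneg : ∑ i, (-u i) ^ 2 ≤ N ^ 2 := by simp only [neg_sq]; exact hu.le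
  have hsq : ∑ i, (u i ^ 2) ^ 2 ≤ (N ^ 2) ^ 2 := by
    rw [← hu]
    exact Finset.sum_sq_le_sq_sum_of_nonneg fun i _ => sq_nonneg _
  have h1 := measureReal_abs_ge_le (measureReal_sum_mul_ge_le hX hind hlaw hσ hv' u hN hu.le hl)
    (by simpa only [neg_mul, Finset.sum_neg_distrib] using
      measureReal_sum_mul_ge_le hX hind hlaw hσ hv' (fun i => -u i) hN hneg hl)
  have h2 := measureReal_abs_ge_le (measureReal_sum_sq_ge_le hX hind hlaw hσ hv' u hN hu.le l)
    (by simpa only [neg_mul, Finset.sum_neg_distrib] using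
      measureReal_sum_sq_ge_le hX hind hlaw hσ hv' (fun i => -u i) hN hneg l)
  have h3 := measureReal_sum_sq_ge_le hX hind hlaw hσ hv' (fun i => u i ^ 2)
    (pow_pos hN 2) hsq l
  simp only [hcoe] at h2 h3
  refine (measureReal_union_le _ _).trans ?_
  have h4 := measureReal_union_le (μ := μ)
    {w | 4 * σ ^ 2 * N * (l + 1) ≤ |∑ i, u i * (X i w ^ 2 - v i)|}
    {w | 4 * σ ^ 2 * N ^ 2 * (l + 1) ≤ ∑ i, u i ^ 2 * (X i w ^ 2 - v i)}
  linarith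

end Deviation

/-! ### Variances, and independence of past and future noise -/

theorem Bandit.variance_nonneg (B : Bandit d) {a : Vec d} (ha : a ∈ B.actions) :
    0 ≤ B.variance a := by
  have h1 := (abs_le.1 (abs_real_inner_le_norm B.φ a)).1
  have h2 : ‖B.φ‖ * ‖a‖ ≤ B.ω * 1 :=
    mul_le_mul B.norm_φ_le (B.norm_action_le a ha) (norm_nonneg _)
      ((norm_nonneg _).trans B.norm_φ_le)
  unfold Bandit.variance link
  linarith

/-- The σ-algebra generated by the noise vector of time `t`. -/
@[reducible] def noiseSpace {Ω : Type*} (B : Bandit d) (η : ℕ → Vec d → Ω → ℝ) (t : ℕ) : MeasurableSpace Ω :=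
  MeasurableSpace.comap (fun w (a : B.actions) => η t a w) inferInstance

theorem measurable_noise {Ω : Type*} {B : Bandit d} (η : ℕ → Vec d → Ω → ℝ) (t : ℕ) {a : Vec d}
    (ha : a ∈ B.actions) : Measurable[noiseSpace B η t] (η t a) :=
  (measurable_pi_apply (⟨a, ha⟩ : B.actions)).comp
    (comap_measurable fun w (a : B.actions) => η t a w)

section Noise

variable {B : Bandit d} {Ω : Type*} [mΩ : MeasurableSpace Ω] {μ : Measure Ω}
  {η : ℕ → Vec d → Ω → ℝ}

theorem IsNoise.noiseSpace_le (hη : IsNoise B μ η) (t : ℕ) : noiseSpace B η t ≤ mΩ :=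
  Measurable.comap_le (measurable_pi_lambda _ fun a => hη.measurable t a a.2)

theorem IsNoise.indep_past_future (hη : IsNoise B μ η) (s : ℕ) :
    Indep (⨆ t ∈ Set.Iio s, noiseSpace B η t) (⨆ t ∈ Set.Ici s, noiseSpace B η t) μ :=
  indep_iSup_of_disjoint hη.noiseSpace_le hη.indep
    (Set.disjoint_left.2 fun t (h1 : t < s) (h2 : s ≤ t) => absurd h1 (not_lt.2 h2))

/-- Each time contributes one coordinate, so dependence between actions at one time is harmless. -/
theorem IsNoise.iIndepFun_select (hη : IsNoise B μ η) {n : ℕ} {A : Fin n → Vec d}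
    (hA : ∀ i, A i ∈ B.actions) (s : ℕ) :
    iIndepFun (fun (i : Fin n) w => η (s + i) (A i) w) μ := by
  have hinj : Function.Injective fun i : Fin n => s + (i : ℕ) := fun i j h => by
    ext; exact Nat.add_left_cancel h
  exact (hη.indep.precomp hinj).comp (fun i x => x (⟨A i, hA i⟩ : B.actions))
    fun i => measurable_pi_apply _

theorem IsNoise.exists_noise_event [IsProbabilityMeasure μ] (hη : IsNoise B μ η) {σ : ℝ}
    (hσ : 0 < σ) (hvar : ∀ a ∈ B.actions, B.variance a ≤ σ ^ 2) {S : Finset (Vec d)}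
    (hS : S ⊆ B.actions) {c : Vec d → ℝ} (hc : ∀ b ∈ S, 0 ≤ c b)
    (hr : ∀ a ∈ S, a ∈ LinearMap.range (Matrix.toEuclideanLin (designMatrix S c)))
    {n : ℕ} {A : Fin n → Vec d} (hAS : ∀ i, A i ∈ S)
    (hA : ∀ f : Vec d → ℝ, ∑ i, f (A i) = ∑ a ∈ S, c a * f a) (s : ℕ) {l : ℝ} (hl : 0 ≤ l) :
    ∃ F : Set Ω, MeasurableSet[⨆ t ∈ Set.Ici s, noiseSpace B η t] F ∧
      μ.real F ≤ B.actions.card * (5 * Real.exp (-l)) ∧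
      ∀ w ∉ F, NoiseControlled S c A (fun i => link B.ω (inner ℝ B.φ (A i))) σ l
        (fun i => η (s + i) (A i) w) := by
  classical
  let D : Vec d → Set Ω := fun a => deviationEvent (fun (i : Fin n) w => η (s + i) (A i) w)
    (fun i => B.variance (A i))
    (fun i => inner ℝ (A i) (Matrix.toEuclideanLin (pinv (designMatrix S c)) a)) σ
    (√(inner ℝ (Matrix.toEuclideanLin (pinv (designMatrix S c)) a) a)) l
  refine ⟨⋃ a ∈ S.filter (· ≠ 0), D a, ?_, ?_, ?_⟩
  · refine Finset.measurableSet_biUnion _ fun a _ => measurableSet_deviationEvent (fun i => ?_) ..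
    exact (measurable_noise η _ (hS (hAS i))).mono
      (le_iSup₂ (f := fun t (_ : t ∈ Set.Ici s) => noiseSpace B η t) (s + (i : ℕ))
        (Nat.le_add_right _ _)) le_rfl
  · have hD : ∀ a ∈ S.filter (· ≠ 0), μ.real (D a) ≤ 5 * Real.exp (-l) := by
      intro a ha
      obtain ⟨haS, h0⟩ := Finset.mem_filter.1 ha
      have hq := inner_pinv_pos hc (hr a haS) h0
      refine measureReal_deviationEvent_le (fun i => hη.measurable _ _ (hS (hAS i)))
        (hη.iIndepFun_select (fun i => hS (hAS i)) s)
        (fun i => B.variance_nonneg (hS (hAS i))) (fun i => hη.law _ _ (hS (hAS i))) hσ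
        (fun i => hvar _ (hS (hAS i))) (Real.sqrt_pos.2 hq) ?_ hl
      rw [Real.sq_sqrt hq.le, ← sum_inner_mul_inner_pinv hA (hr a haS)]
      exact Finset.sum_congr rfl fun i _ => sq _
    refine (measureReal_biUnion_finset_le _ _).trans ((Finset.sum_le_sum hD).trans ?_)
    rw [Finset.sum_const, nsmul_eq_mul]
    gcongr
    exact (Finset.filter_subset _ _).trans hS
  · intro w hw a ha h0 u hu
    subst hu
    have hwD : w ∉ D a := fun h => hw
      (Set.mem_biUnion (Finset.mem_coe.2 (Finset.mem_filter.2 ⟨ha, h0⟩)) h)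
    simp only [D, deviationEvent, Set.mem_union, Set.mem_ofPred_eq, not_or, not_le] at hwD
    exact ⟨hwD.1.le, hwD.2.1.le, hwD.2.2.le⟩

end Noise

/-! ### The confidence width -/

theorem width_mul_le {d K T : ℕ} {σ ρ δ C ε : ℝ} (hd : 2 ≤ d) (hK : 1 ≤ K) (hT : 2 ≤ T)
    (hσ : 0 < σ) (hρ : 0 ≤ ρ) (hδ : 0 < δ) (hδ1 : δ < 1) (hε : 0 < ε)
    (hC : 8 * ρ * σ * √((d : ℝ) + Real.log (2 * (T : ℝ) ^ 2 / δ))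
        + 50 * σ ^ 2 * d * √(Real.log d) * Real.log ((T : ℝ) / δ)
      ≤ C * d * √(Real.log d) * Real.log ((T : ℝ) / δ)) :
    0 ≤ Real.log (5 * ((K : ℝ) * T / δ)) ∧
    0 < C ^ 2 * d ^ 2 * Real.log d * Real.log ((K : ℝ) * T / δ) ^ 2 / ε ^ 2 ∧
    √(C ^ 2 * d ^ 2 * Real.log d * Real.log ((K : ℝ) * T / δ) ^ 2 / ε ^ 2)⁻¹
      * (ρ * (σ * √(2 * Real.log (5 * ((K : ℝ) * T / δ))))
        + σ ^ 2 * d * (8 * Real.log (5 * ((K : ℝ) * T / δ)) + 5)) ≤ ε := by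
  have hd' : (2 : ℝ) ≤ d := by exact_mod_cast hd
  have hK' : (1 : ℝ) ≤ K := by exact_mod_cast hK
  have hT' : (2 : ℝ) ≤ T := by exact_mod_cast hT
  have hTδ : 2 ≤ (T : ℝ) / δ := by rw [le_div_iff₀ hδ]; nlinarith
  have hKT : (T : ℝ) / δ ≤ (K : ℝ) * T / δ := by
    gcongr
    nlinarith
  have hy2 : 2 ≤ (K : ℝ) * T / δ := hTδ.trans hKT
  have hlog2 : 0.69 < Real.log 2 := by linarith [Real.log_two_gt_d9]
  have hx : 0.69 < Real.log ((T : ℝ) / δ) :=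
    hlog2.trans_le (Real.log_le_log two_pos hTδ)
  have hxL : Real.log ((T : ℝ) / δ) ≤ Real.log ((K : ℝ) * T / δ) :=
    Real.log_le_log (by linarith) hKT
  -- 5y ≤ y⁴ for y ≥ 2.
  have hl4 : Real.log (5 * ((K : ℝ) * T / δ)) ≤ 4 * Real.log ((K : ℝ) * T / δ) := by
    generalize (K : ℝ) * T / δ = y at hy2
    have h5 : (5 : ℝ) * y ≤ y ^ 4 := by
      have h3 : (5 : ℝ) ≤ y ^ 3 := by
        have := pow_le_pow_left₀ (by norm_num) hy2 3
        linarith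
      nlinarith
    calc Real.log (5 * y) ≤ Real.log (y ^ 4) := Real.log_le_log (by linarith) h5
      _ = 4 * Real.log y := by rw [Real.log_pow]; norm_num
  have hl0 : 0 ≤ Real.log (5 * ((K : ℝ) * T / δ)) := Real.log_nonneg (by linarith)
  have hM : Real.log ((T : ℝ) / δ) ≤ (d : ℝ) + Real.log (2 * (T : ℝ) ^ 2 / δ) := by
    have : Real.log ((T : ℝ) / δ) ≤ Real.log (2 * (T : ℝ) ^ 2 / δ) := by
      refine Real.log_le_log (by linarith) ?_
      gcongr
      nlinarith
    linarith
  have hlogd : 0.69 < Real.log d := hlog2.trans_le (Real.log_le_log two_pos hd')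
  have hsd : 0.8 ≤ √(Real.log d) := by
    rw [Real.le_sqrt (by norm_num) (by linarith)]
    linarith
  have hsqd : √(Real.log d) ^ 2 = Real.log d := Real.sq_sqrt (by linarith)
  generalize Real.log (5 * ((K : ℝ) * T / δ)) = l at *
  generalize Real.log ((K : ℝ) * T / δ) = L at *
  generalize Real.log ((T : ℝ) / δ) = x at *
  generalize (d : ℝ) + Real.log (2 * (T : ℝ) ^ 2 / δ) = M at *
  rw [← hsqd]
  generalize √(Real.log d) = q at *
  have hx0 : 0 < x := by linarith
  have hL0 : 0 < L := by linarith
  have hq0 : 0 < q := by linarith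
  have hd0 : (0 : ℝ) < d := by linarith
  have hCpos : 0 < C := by
    have h1 : 0 ≤ 8 * ρ * σ * √M := by positivity
    have h2 : 0 < 50 * σ ^ 2 * d * q * x := by positivity
    have h3 : 0 < C * (d * q * x) := by linarith
    exact pos_of_mul_pos_left h3 (by positivity)
  have hroot : C ^ 2 * d ^ 2 * q ^ 2 * L ^ 2 / ε ^ 2 = (C * d * q * L / ε) ^ 2 := by ring
  have hw : 0 < C * d * q * L / ε := by positivity
  refine ⟨hl0, by positivity, ?_⟩
  rw [hroot, ← inv_pow, Real.sqrt_sq (by positivity), inv_mul_le_iff₀ hw,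
    div_mul_cancel₀ _ hε.ne']
  -- The hypothesis on C involves x = log(T/δ), the plays L = log(KT/δ); scaling by L/x ≥ 1 converts
  -- one into the other.
  have hsqrt : √(2 * l) ≤ 8 * √M * (L / x) := by
    have h1 : √x ≤ √M := Real.sqrt_le_sqrt hM
    have h2 : √(2 * l) ≤ 8 * √x * (L / x) := by
      refine Real.sqrt_le_iff.2 ⟨by positivity, ?_⟩
      rw [mul_pow, mul_pow, Real.sq_sqrt hx0.le, div_pow]
      have : 8 ^ 2 * x * (L ^ 2 / x ^ 2) = 64 * L * (L / x) := by field_simp; ring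
      rw [this]
      have h3 : 1 ≤ L / x := (one_le_div hx0).2 hxL
      nlinarith
    exact h2.trans (by gcongr)
  -- Source of the constant 50: 8l + 5 ≤ 32L + 5 ≤ 40L, and q ≥ 0.8.
  have hquad : 8 * l + 5 ≤ 50 * q * L := by nlinarith
  calc ρ * (σ * √(2 * l)) + σ ^ 2 * d * (8 * l + 5)
      ≤ ρ * (σ * (8 * √M * (L / x))) + σ ^ 2 * d * (50 * q * L) := by gcongr
    _ = (8 * ρ * σ * √M + 50 * σ ^ 2 * d * q * x) * (L / x) := by field_simp
    _ ≤ (C * d * q * x) * (L / x) := by gcongr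
    _ = C * d * q * L := by field_simp

/-! ### The union bound over the phases -/

/-- Conditioning on which E_i occurs: ∑ μ(E_i)μ(F_i) ≤ p ∑ μ(E_i) ≤ p, whatever the number of
indices. -/
theorem measureReal_biUnion_inter_le {Ω κ : Type*} [MeasurableSpace Ω] {μ : Measure Ω}
    [IsProbabilityMeasure μ] {s : Finset κ} {E F : κ → Set Ω} {p : ℝ} (hp : 0 ≤ p)
    (hE : ∀ i ∈ s, MeasurableSet (E i)) (hdisj : Set.PairwiseDisjoint (s : Set κ) E)
    (hind : ∀ i ∈ s, μ (E i ∩ F i) = μ (E i) * μ (F i)) (hF : ∀ i ∈ s, μ.real (F i) ≤ p) :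
    μ.real (⋃ i ∈ s, E i ∩ F i) ≤ p := by
  calc μ.real (⋃ i ∈ s, E i ∩ F i) ≤ ∑ i ∈ s, μ.real (E i ∩ F i) :=
        measureReal_biUnion_finset_le _ _
    _ ≤ ∑ i ∈ s, μ.real (E i) * p := by
        refine Finset.sum_le_sum fun i hi => ?_
        rw [measureReal_def, hind i hi, ENNReal.toReal_mul]
        exact mul_le_mul_of_nonneg_left (hF i hi) measureReal_nonneg
    _ = μ.real (⋃ i ∈ s, E i) * p := by
        rw [← Finset.sum_mul, measureReal_biUnion_finset hdisj hE]
    _ ≤ p := mul_le_of_le_one_left hp measureReal_le_one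

theorem ofReal_one_sub_le_of_compl_subset {Ω : Type*} [MeasurableSpace Ω] {μ : Measure Ω}
    [IsProbabilityMeasure μ] {G H : Set Ω} {δ : ℝ} (hsub : Gᶜ ⊆ H) (hH : μ.real H ≤ δ) :
    ENNReal.ofReal (1 - δ) ≤ μ G := by
  have h1 : μ.real Set.univ ≤ μ.real G + μ.real H := by
    refine (measureReal_mono ?_).trans (measureReal_union_le G H)
    intro w _
    by_cases hw : w ∈ G
    · exact Or.inl hw
    · exact Or.inr (hsub hw)
  rw [probReal_univ] at h1
  rw [ENNReal.ofReal_le_iff_le_toReal (measure_ne_top _ _)]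
  change 1 - δ ≤ μ.real G
  linarith

theorem Input.Valid.exists_phase_event {B : Bandit d} {I : Input d} (hI : I.Valid)
    (hact : I.actions = B.actions) (hω : I.ω = B.ω) (hd : 2 ≤ d) (hρ : 0 ≤ I.ρ)
    {σ l ε : ℝ} (hσ : 0 < σ) (hvar : ∀ a ∈ B.actions, B.variance a ≤ σ ^ 2) (hl : 0 ≤ l)
    {ℓ : ℕ} (hℓ : 1 ≤ ℓ) (hscale : 0 < I.scale ℓ)
    (hwidth : √(I.scale ℓ)⁻¹ * (I.ρ * (σ * √(2 * l)) + σ ^ 2 * d * (8 * l + 5)) ≤ ε)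
    {Ω : Type*} [MeasurableSpace Ω] {μ : Measure Ω} [IsProbabilityMeasure μ]
    {η : ℕ → Vec d → Ω → ℝ} (hη : IsNoise B μ η) (s : ℕ) {S : Finset (Vec d)}
    (hS : S ⊆ I.actions) (hne : S.Nonempty) :
    ∃ F : Set Ω, MeasurableSet[⨆ t ∈ Set.Ici s, noiseSpace B η t] F ∧
      μ.real F ≤ B.actions.card * (5 * Real.exp (-l)) ∧
      ∀ w ∉ F, ∀ a ∈ S,
        |inner ℝ (I.ρ • B.θ - B.φ - (I.ρ • I.thetaHat (B.reward η w) ℓ s S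
          - I.phiHat (B.reward η w) ℓ s S)) a| ≤ ε := by
  have hform := fun a (ha : a ∈ S) =>
    Input.sq_inner_le_phaseMatrix hI hℓ hS hne hscale ha
  have hr := fun a (ha : a ∈ S) =>
    mem_range_of_sq_inner_le (isHermitian_designMatrix _ _) (hform a ha)
  have hc : ∀ b ∈ S, 0 ≤ (I.plays ℓ S b : ℝ) := fun b _ => Nat.cast_nonneg _
  have hA := Input.sum_schedule hI hℓ hS hne
  have hAS : ∀ i, (I.schedule ℓ S).get i ∈ S := fun i =>
    Input.mem_of_mem_schedule hI hℓ hS hne (List.get_mem _ i)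
  have hSB : S ⊆ B.actions := hact ▸ hS
  obtain ⟨F, hFm, hFμ, hF⟩ := hη.exists_noise_event hσ hvar hSB hc hr hAS hA s hl
  refine ⟨F, hFm, hFμ, fun w hw a ha => ?_⟩
  refine (abs_inner_error_le hA hAS hc hr hρ hσ hl (fun b hb => hvar b (hSB hb)) (hF w hw)
    (θ' := I.thetaHat (B.reward η w) ℓ s S) (φ' := I.phiHat (B.reward η w) ℓ s S) rfl
    (by rw [← hω]; rfl) ha hd).trans (le_trans ?_ hwidth)
  gcongr
  rw [inner_pinv_apply_left]
  exact inner_pinv_le_of_sq_inner_le (isHermitian_designMatrix _ _) (inv_nonneg.2 hscale.le)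
    (hform a ha)

end RiskBandit

/-! ### Assembly of the claim -/

theorem mainTheorem6 :
    ∃ C₄ : ℝ, 0 < C₄ ∧
      ∀ (d : ℕ) (_ : 2 ≤ d) (B : RiskBandit.Bandit d)
        (σmax : ℝ) (_ : 0 < σmax) (_ : ∀ a ∈ B.actions, B.variance a ≤ σmax ^ 2)
        (I : RiskBandit.Input d) (_ : I.actions = B.actions) (_ : I.ω = B.ω)
        (_ : 0 ≤ I.ρ) (_ : 2 ≤ I.T) (_ : 0 < I.δ)
        (_ : 8 * I.ρ * σmax * √((d : ℝ) + Real.log (2 * (I.T : ℝ) ^ 2 / I.δ))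
              + C₄ * σmax ^ 2 * d * √(Real.log d) * Real.log ((I.T : ℝ) / I.δ)
            ≤ I.Chat * d * √(Real.log d) * Real.log ((I.T : ℝ) / I.δ))
        (_ : I.Valid)
        {Ω : Type*} [MeasurableSpace Ω] (μ : MeasureTheory.Measure Ω)
        [MeasureTheory.IsProbabilityMeasure μ]
        (η : ℕ → RiskBandit.Vec d → Ω → ℝ) (_ : RiskBandit.IsNoise B μ η),
        ENNReal.ofReal (1 - I.δ) ≤
          μ {w | ∀ ℓ : ℕ, 1 ≤ ℓ → I.Completed (B.reward η w) ℓ →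
            ∀ a ∈ I.active (B.reward η w) ℓ,
              |inner ℝ (I.ρ • B.θ - B.φ
                  - (I.ρ • I.thetaEst (B.reward η w) ℓ - I.phiEst (B.reward η w) ℓ)) a|
                ≤ RiskBandit.tol ℓ} := by
  classical
  refine ⟨50, by norm_num, ?_⟩
  intro d hd B σ hσ hvar I hact hω hρ hT hδ hC hI Ω _ μ _ η hη
  rcases le_or_gt 1 I.δ with hδ1 | hδ1
  · rw [ENNReal.ofReal_of_nonpos (by linarith)]
    exact zero_le
  have hne : I.actions.Nonempty := hact ▸ B.actions_nonempty
  have htol : ∀ ℓ, 0 < RiskBandit.tol ℓ := fun ℓ => by unfold RiskBandit.tol; positivity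
  have hw := fun ℓ => RiskBandit.width_mul_le hd hne.card_pos hT hσ hρ hδ hδ1 (htol ℓ) hC
  -- Chosen so that five tails for each of K actions cost δ/T in a phase.
  obtain ⟨l, hldef⟩ : ∃ l, l = Real.log (5 * ((I.actions.card : ℝ) * I.T / I.δ)) := ⟨_, rfl⟩
  rw [← hldef] at hw
  have hscale : ∀ ℓ, 0 < I.scale ℓ := fun ℓ => (hw ℓ).2.1
  have hF : ∀ (ℓ : ℕ) (p : ℕ × Finset (RiskBandit.Vec d)), p.2 ⊆ I.actions ∧ p.2.Nonempty → _ :=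
    fun ℓ p hp => hI.exists_phase_event hact hω hd hρ hσ hvar (hw 0).1 (Nat.succ_pos ℓ)
      (hscale _) (hw _).2.2 hη p.1 hp.1 hp.2
  choose! F hFm hFμ hF using hF
  have hT0 : (0 : ℝ) < I.T := by exact_mod_cast (by omega : 0 < I.T)
  have hK0 : (0 : ℝ) < I.actions.card := by exact_mod_cast hne.card_pos
  have hprob : (B.actions.card : ℝ) * (5 * Real.exp (-l)) = I.δ / I.T := by
    rw [hldef, Real.exp_neg, Real.exp_log (by positivity), ← hact]
    field_simp
  rw [hprob] at hFμ
  let E : ℕ → ℕ × Finset (RiskBandit.Vec d) → Set Ω := fun ℓ p =>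
    {w | I.phase (B.reward η w) (ℓ + 1) = p}
  have hEm : ∀ ℓ p,
      MeasurableSet[⨆ t ∈ Set.Iio p.1, RiskBandit.noiseSpace B η t] (E ℓ p) := by
    refine fun ℓ p => RiskBandit.Input.measurableSet_phase_eq hI hne (fun t a ha => ?_) ℓ p.1 p.2
    unfold RiskBandit.Bandit.reward
    exact (RiskBandit.measurable_noise η t (hact ▸ ha)).const_add _
  -- All states a completed phase can be in; a phase without rounds may start at T itself.
  let P : Finset (ℕ × Finset (RiskBandit.Vec d)) :=
    Finset.range (I.T + 1) ×ˢ I.actions.powerset.filter Finset.Nonempty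
  have hP : ∀ p ∈ P, p.2 ⊆ I.actions ∧ p.2.Nonempty := fun p hp => by
    simpa using (Finset.mem_product.1 hp).2
  have hphase : ∀ ℓ, μ.real (⋃ p ∈ P, E ℓ p ∩ F ℓ p) ≤ I.δ / I.T := by
    intro ℓ
    refine RiskBandit.measureReal_biUnion_inter_le (by positivity)
      (fun p _ => (iSup₂_le fun t _ => hη.noiseSpace_le t : _ ≤ _) _ (hEm ℓ p)) ?_
      (fun p hp => ?_) fun p hp => hFμ ℓ p (hP p hp)
    · exact fun p _ q _ hpq => Set.disjoint_left.2 fun w h1 h2 => hpq (h1.symm.trans h2)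
    · exact (ProbabilityTheory.Indep_iff _ _ μ).1 (hη.indep_past_future p.1) _ _ (hEm ℓ p)
        (hFm ℓ p (hP p hp))
  refine RiskBandit.ofReal_one_sub_le_of_compl_subset
    (H := ⋃ ℓ ∈ Finset.range I.T, ⋃ p ∈ P, E ℓ p ∩ F ℓ p) ?_ ?_
  · intro w hw'
    simp only [Set.mem_compl_iff, Set.mem_ofPred_eq, not_forall] at hw'
    obtain ⟨k, hk, hcomp, a, ha, hbad⟩ := hw'
    obtain ⟨ℓ, rfl⟩ : ∃ ℓ, k = ℓ + 1 := ⟨k - 1, by omega⟩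
    -- The estimate is trivial at a = 0. For a ≠ 0 the phase index is bounded by the horizon, so T
    -- phases suffice.
    have h0 : a ≠ 0 := by
      rintro rfl
      exact hbad (by simpa using (htol _).le)
    have hℓT := hcomp.le_horizon hI hscale ha h0
    have hp : I.phase (B.reward η w) (ℓ + 1) ∈ P := by
      have h1 : I.startTime (B.reward η w) (ℓ + 1) ≤ I.T := (Nat.le_add_right _ _).trans hcomp
      refine Finset.mem_product.2 ⟨Finset.mem_range.2 (Nat.lt_succ_of_le h1), ?_⟩
      exact Finset.mem_filter.2 ⟨Finset.mem_powerset.2 (RiskBandit.Input.active_subset _ ℓ),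
        RiskBandit.Input.active_nonempty hne _ ℓ⟩
    refine Set.mem_biUnion (Finset.mem_coe.2 (Finset.mem_range.2 hℓT))
      (Set.mem_biUnion (Finset.mem_coe.2 hp) ⟨rfl, ?_⟩)
    by_contra hF'
    exact hbad (hF ℓ _ (hP _ hp) w hF' a ha)
  · refine (MeasureTheory.measureReal_biUnion_finset_le _ _).trans
      ((Finset.sum_le_sum fun ℓ _ => hphase ℓ).trans (le_of_eq ?_))
    rw [Finset.sum_const, Finset.card_range, nsmul_eq_mul]
    field_simp
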